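/- **Definitions.** A *tubular group* is the fundamental group $G=\pi_1(\mathcal G,v_0)$ of a finite connected graph of groups $\mathcal G$ in which every vertex group $G_v$ is isomorphic to $\mathbb Z^2$ and every edge group $G_e$ is isomorphic to $\mathbb Z$; the underlying graph $\Gamma$ (loops and multiple edges allowed) has oriented edges $e\in\mathcal E$ with initial and terminal vertices $-e$, $+e$, and $\varphi_e^{\pm}\colon G_e\to G_{\pm e}$ are the injective attaching maps. The tubular group (with its splitting) is *primitive* if for every edge $e$ both $\varphi_e^{-}(G_e)$ and $\varphi_e^{+}(G_e)$ are maximal cyclic subgroups of $G_{-e}$ and $G_{+e}$. A *morphism* of groups split as graphs of groups is a homomorphism $f\colon G\to G'$ together with a morphism $f_*$ of the underlying undirected graphs such that $f$ restricts to homomorphisms $f_v\colon G_v\to G'_{f_*(v)}$ and $f_e\colon G_e\to G'_{f_*(e)}$ commuting with the attaching maps; it is *rigid* if $f_*$ is an isomorphism and all $f_v$, $f_e$ are injective. $G$ has a *primitive target* if there is a rigid morphism from $G$ to a primitive tubular group, and a *primitive domain* if there is a rigid morphism to $G$ from a primitive tubular group. $G$ is *virtually primitive* if some finite index subgroup of $G$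 is a primitive tubular group, i.e. is isomorphic to the fundamental group of a primitive tubular graph of groups. A subgroup of $G$ is *separable* if it is an intersection of finite index subgroups of $G$. For a tuple $\underline k=(k_e)_{e\in\mathcal E}$ of integers let $G_v^{(\underline k)}\le G_v$ be the subgroup generated by the images, under all attaching maps into $G_v$, of the subgroups $k_eG_e$; the $\mathcal E$-tuple $\underline k$ is *regulating* if for every edge $e$, every generator $g_e$ of $G_e$ and each sign, the element $\varphi_e^{\pm}(k_eg_e)$ is primitive in $G_{\pm e}^{(\underline k)}$, that is, nontrivial and not a proper multiple ($n y$ with $|n|\neq 1$) of an element $y$ of $G_{\pm e}^{(\underline k)}$. **Theorem.** Let $G$ be a tubular group. The following are equivalent: 1. $G$ is residually finite; 2. $G$ has a primitive domain; 3. $G$ has a primitive target; 4. $G$ is virtually primitive; 5. every edge group of $G$ (embedded in $G$ as a subgroup, up to conjugation) is separable in $G$; 6. $G$ has a regulating $\mathcal E$-tuple. -/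

import Mathlib

universe u

/-- A graph of groups. Every edge `e` is oriented: its initial vertex is `vert e false`, its
terminal vertex is `vert e true`, and `att e false`, `att e true` are the inclusions of the edge
group in the vertex groups of the initial and of the terminal vertex. Loops and multiple edges
are allowed. -/
structure GraphOfGroups where
  V : Type u
  E : Type u
  vert : E → Bool → V
  vGrp : V → Type u
  eGrp : E → Type u
  [vGroup : ∀ v, Group (vGrp v)]
  [eGroup : ∀ e, Group (eGrp e)]
  att : ∀ (e : E) (s : Bool), eGrp e →* vGrp (vert e s)
  att_injective : ∀ (e : E) (s : Bool), Function.Injective (att e s)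

attribute [instance] GraphOfGroups.vGroup GraphOfGroups.eGroup

namespace GraphOfGroups

/-- The free product of all vertex groups and of the free group on the edges. -/
abbrev PrePathGroup (𝒢 : GraphOfGroups.{u}) : Type u :=
  Monoid.Coprod (Monoid.CoprodI 𝒢.vGrp) (FreeGroup 𝒢.E)

/-- The relators `t_e φ_e⁺(g) t_e⁻¹ φ_e⁻(g)⁻¹`. -/
def pathRel (𝒢 : GraphOfGroups.{u}) : Set 𝒢.PrePathGroup :=
  {r | ∃ (e : 𝒢.E) (g : 𝒢.eGrp e), r =
    Monoid.Coprod.inr (FreeGroup.of e) * Monoid.Coprod.inl (Monoid.CoprodI.of (𝒢.att e true g)) *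
    (Monoid.Coprod.inr (FreeGroup.of e))⁻¹ *
    (Monoid.Coprod.inl (Monoid.CoprodI.of (𝒢.att e false g)))⁻¹}

/-- The path group of a graph of groups: it is generated by the vertex groups and one letter `t_e`
for each edge, subject to `t_e φ_e⁺(g) t_e⁻¹ = φ_e⁻(g)` for `g` in the edge group of `e`. -/
abbrev PathGroup (𝒢 : GraphOfGroups.{u}) : Type u :=
  𝒢.PrePathGroup ⧸ Subgroup.normalClosure 𝒢.pathRel

/-- The canonical map from a vertex group to the path group. -/
def ofV (𝒢 : GraphOfGroups.{u}) (v : 𝒢.V) : 𝒢.vGrp v →* 𝒢.PathGroup :=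
  (QuotientGroup.mk' _).comp (Monoid.Coprod.inl.comp Monoid.CoprodI.of)

/-- The element `t_e` of the path group. -/
def letter (𝒢 : GraphOfGroups.{u}) (e : 𝒢.E) : 𝒢.PathGroup :=
  QuotientGroup.mk' _ (Monoid.Coprod.inr (FreeGroup.of e))

/-- `𝒢.IsPath u v x`: the element `x` of the path group is represented by a path from `u` to `v`,
that is, by a word `g₀ t₁ g₁ ⋯ tₙ gₙ` in which `t₁, …, tₙ` are the letters (or inverse letters) of
the consecutive edges of an edge path from `u` to `v` in the underlying graph, and the `gᵢ` belong
to the vertex groups at the consecutive vertices of that edge path. -/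
inductive IsPath (𝒢 : GraphOfGroups.{u}) : 𝒢.V → 𝒢.V → 𝒢.PathGroup → Prop
  | ofV (v : 𝒢.V) (g : 𝒢.vGrp v) : IsPath 𝒢 v v (𝒢.ofV v g)
  | letter (e : 𝒢.E) : IsPath 𝒢 (𝒢.vert e false) (𝒢.vert e true) (𝒢.letter e)
  | inv {v w : 𝒢.V} {x : 𝒢.PathGroup} : IsPath 𝒢 v w x → IsPath 𝒢 w v x⁻¹
  | mul {v w z : 𝒢.V} {x y : 𝒢.PathGroup} :
      IsPath 𝒢 v w x → IsPath 𝒢 w z y → IsPath 𝒢 v z (x * y)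

/-- The fundamental group of a graph of groups at the base vertex `v`, as the subgroup of the
path group that consists of the elements represented by closed paths at `v`. -/
def piOne (𝒢 : GraphOfGroups.{u}) (v : 𝒢.V) : Subgroup 𝒢.PathGroup where
  carrier := {x | 𝒢.IsPath v v x}
  mul_mem' := IsPath.mul
  one_mem' := by simpa using IsPath.ofV (𝒢 := 𝒢) v 1
  inv_mem' := IsPath.inv

/-- The underlying graph is connected (and has a vertex). -/
def Connected (𝒢 : GraphOfGroups.{u}) : Prop :=
  Nonempty 𝒢.V ∧ ∀ v w : 𝒢.V,
    Relation.EqvGen (fun a b => ∃ e, 𝒢.vert e false = a ∧ 𝒢.vert e true = b) v w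

/-- A tubular graph of groups: a finite connected graph of groups with vertex groups `ℤ²` and
edge groups `ℤ`. -/
structure IsTubular (𝒢 : GraphOfGroups.{u}) : Prop where
  finite_V : Finite 𝒢.V
  finite_E : Finite 𝒢.E
  connected : 𝒢.Connected
  vGrp_equiv : ∀ v, Nonempty (𝒢.vGrp v ≃* Multiplicative (ℤ × ℤ))
  eGrp_equiv : ∀ e, Nonempty (𝒢.eGrp e ≃* Multiplicative ℤ)

/-- Every edge group is a maximal cyclic subgroup of each of its vertex groups. -/
def IsPrimitive (𝒢 : GraphOfGroups.{u}) : Prop :=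
  ∀ (e : 𝒢.E) (s : Bool),
    Maximal (fun C : Subgroup (𝒢.vGrp (𝒢.vert e s)) => IsCyclic C) (𝒢.att e s).range

/-- A morphism of graphs of groups: a homomorphism together with a map `onV`, `onE` of the
underlying undirected graphs (`rev e` records whether the orientation of the edge `e` is reversed)
such that the homomorphism restricts to homomorphisms `homV v`, `homE e` of the vertex groups and
of the edge groups. The homomorphism is recorded on the path group, so that no base vertex has
to be chosen; `Morphism.hom` is the homomorphism of fundamental groups. -/
structure Morphism (𝒢 ℋ : GraphOfGroups.{u}) where
  toHom : 𝒢.PathGroup →* ℋ.PathGroup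
  onV : 𝒢.V → ℋ.V
  onE : 𝒢.E → ℋ.E
  rev : 𝒢.E → Bool
  homV : ∀ v, 𝒢.vGrp v →* ℋ.vGrp (onV v)
  homE : ∀ e, 𝒢.eGrp e →* ℋ.eGrp (onE e)
  /-- The maps on vertices and edges respect incidence, and on the edge group of `e` one has
  `homV ∘ att e s = att (onE e) s' ∘ homE`, where `s'` is the end that corresponds to `s`. The
  equation between dependent pairs states the equality of the vertices and of the elements of
  their vertex groups at once. -/
  comm : ∀ (e : 𝒢.E) (s : Bool) (g : 𝒢.eGrp e),
    (⟨onV (𝒢.vert e s), homV _ (𝒢.att e s g)⟩ : Σ w, ℋ.vGrp w) =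
      ⟨ℋ.vert (onE e) (xor (rev e) s), ℋ.att (onE e) (xor (rev e) s) (homE e g)⟩
  toHom_ofV : ∀ (v : 𝒢.V) (g : 𝒢.vGrp v), toHom (𝒢.ofV v g) = ℋ.ofV (onV v) (homV v g)
  /-- The image of a path is a path between the image vertices. -/
  toHom_letter : ∀ e : 𝒢.E,
    ℋ.IsPath (onV (𝒢.vert e false)) (onV (𝒢.vert e true)) (toHom (𝒢.letter e))

namespace Morphism

theorem isPath_toHom {𝒢 ℋ : GraphOfGroups.{u}} (f : Morphism 𝒢 ℋ) {v w : 𝒢.V}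
    {x : 𝒢.PathGroup} (h : 𝒢.IsPath v w x) : ℋ.IsPath (f.onV v) (f.onV w) (f.toHom x) := by
  induction h with
  | ofV v g => rw [f.toHom_ofV]; exact IsPath.ofV _ _
  | letter e => exact f.toHom_letter e
  | inv _ ih => rw [map_inv]; exact ih.inv
  | mul _ _ ih₁ ih₂ => rw [map_mul]; exact ih₁.mul ih₂

/-- The homomorphism of fundamental groups given by a morphism of graphs of groups. -/
def hom {𝒢 ℋ : GraphOfGroups.{u}} (f : Morphism 𝒢 ℋ) (v : 𝒢.V) :
    𝒢.piOne v →* ℋ.piOne (f.onV v) :=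
  (f.toHom.comp (𝒢.piOne v).subtype).codRestrict _ fun x => f.isPath_toHom x.2

/-- A rigid morphism: an isomorphism on the underlying graphs, injective on every vertex group and
on every edge group. -/
structure IsRigid {𝒢 ℋ : GraphOfGroups.{u}} (f : Morphism 𝒢 ℋ) : Prop where
  onV_bijective : Function.Bijective f.onV
  onE_bijective : Function.Bijective f.onE
  homV_injective : ∀ v, Function.Injective (f.homV v)
  homE_injective : ∀ e, Function.Injective (f.homE e)

end Morphism

/-- There is a rigid morphism from `𝒢` to a primitive tubular graph of groups. -/
def HasPrimitiveTarget (𝒢 : GraphOfGroups.{u}) : Prop :=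
  ∃ ℋ : GraphOfGroups.{u}, ℋ.IsTubular ∧ ℋ.IsPrimitive ∧ ∃ f : Morphism 𝒢 ℋ, f.IsRigid

/-- There is a rigid morphism to `𝒢` from a primitive tubular graph of groups. -/
def HasPrimitiveDomain (𝒢 : GraphOfGroups.{u}) : Prop :=
  ∃ ℋ : GraphOfGroups.{u}, ℋ.IsTubular ∧ ℋ.IsPrimitive ∧ ∃ f : Morphism ℋ 𝒢, f.IsRigid

/-- The edge group of `e` as a subgroup of the fundamental group at `v`, by means of a path `p`
from `v` to the initial vertex of `e`: the elements `p φ_e⁻(g) p⁻¹`. -/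
def edgeSubgroup (𝒢 : GraphOfGroups.{u}) (v : 𝒢.V) (e : 𝒢.E) (p : 𝒢.PathGroup) :
    Subgroup (𝒢.piOne v) :=
  (((𝒢.ofV _).comp (𝒢.att e false)).range.map (MulAut.conj p).toMonoidHom).subgroupOf (𝒢.piOne v)

/-- The subset of the vertex groups that consists of the images, under all attaching maps, of the
subgroups `k_e G_e` of the edge groups (written multiplicatively). -/
inductive ScaledEdgeElement (𝒢 : GraphOfGroups.{u}) (k : 𝒢.E → ℤ) : ∀ v : 𝒢.V, 𝒢.vGrp v → Prop
  | mk (e : 𝒢.E) (s : Bool) (g : 𝒢.eGrp e) :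
      ScaledEdgeElement 𝒢 k (𝒢.vert e s) (𝒢.att e s (g ^ k e))

/-- The subgroup of the vertex group at `v` generated by the images, under the attaching maps, of
the subgroups `k_e G_e` of the edge groups. -/
def scaledSubgroup (𝒢 : GraphOfGroups.{u}) (k : 𝒢.E → ℤ) (v : 𝒢.V) : Subgroup (𝒢.vGrp v) :=
  Subgroup.closure {x | 𝒢.ScaledEdgeElement k v x}

end GraphOfGroups

/-- `x` is a primitive element of the subgroup `K`: it is nontrivial, lies in `K`, and is not a
proper power of an element of `K`. -/
def IsPrimitiveElement {A : Type*} [Group A] (K : Subgroup A) (x : A) : Prop :=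
  x ∈ K ∧ x ≠ 1 ∧ ∀ y ∈ K, ∀ n : ℤ, y ^ n = x → n = 1 ∨ n = -1

/-- The tuple `k` of integers is regulating: for every edge `e` and generator `g` of the edge
group, both images of `g ^ k_e` are primitive in the subgroups of the vertex groups generated by
the images of all the subgroups `k_e G_e`. -/
def GraphOfGroups.IsRegulating (𝒢 : GraphOfGroups.{u}) (k : 𝒢.E → ℤ) : Prop :=
  ∀ (e : 𝒢.E) (g : 𝒢.eGrp e), Subgroup.zpowers g = ⊤ → ∀ s : Bool,
    IsPrimitiveElement (𝒢.scaledSubgroup k (𝒢.vert e s)) (𝒢.att e s (g ^ k e))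

/-- A subgroup is separable if it is an intersection of subgroups of finite index. -/
def IsSeparableSubgroup {G : Type*} [Group G] (H : Subgroup G) : Prop :=
  ∃ S : Set (Subgroup G), (∀ K ∈ S, K.FiniteIndex) ∧ H = sInf S

/-- A group that splits as a primitive tubular graph of groups. -/
def IsPrimitiveTubularGroup (H : Type u) [Group H] : Prop :=
  ∃ 𝒦 : GraphOfGroups.{u}, 𝒦.IsTubular ∧ 𝒦.IsPrimitive ∧ ∃ w : 𝒦.V, Nonempty (H ≃* 𝒦.piOne w)

/-- A group with a subgroup of finite index that is a primitive tubular group. -/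
def IsVirtuallyPrimitive (G : Type u) [Group G] : Prop :=
  ∃ H : Subgroup G, H.FiniteIndex ∧ IsPrimitiveTubularGroup H

/-!
For integers `k_e` and subgroups `H v` of finite index in the vertex groups, say that `k` regulates
through `H` if both images of the `k_e`-th power of a generator of the edge group of `e` are
primitive elements of `H v`. All six properties amount to the existence of such a pair `(k, H)`.

If `k` is regulating, the subgroup generated by the scaled edge groups can be enlarged to a subgroup
of finite index in which it is pure (`exists_finiteIndex_pure`). Conversely, primitivity passes to
smaller subgroups (`Coordinates.Regulates.isRegulating`). A pair `(k, H)` is the same as a primitive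
domain with vertex groups `H v`; and a rigid morphism between tubular graphs of groups can be
reversed by composing with multiplication by a suitable integer (`exists_isRigid_symm`), so that
primitive domains and primitive targets are the same thing.

The tool for the remaining implications is `Coordinates.exists_hom_perm`. Let `L v` be subgroups of
the vertex groups `ℤ²` that cut out the same subgroup of each edge group from both ends. The path
group then acts on `I × ∏ v, ℤ² / L v`: each vertex group translates its own factor, and the letter
`t_e` acts by any permutation that conjugates one of the two translations by the generator of the
edge group to the other. Such a permutation may be prescribed at finitely many points in different
orbits, so that a word that is reduced modulo `L` can be made to move a point along a chain of
points with different `I`-coordinates. The choice `L = 0`, `I = ℕ` gives the normal form theorem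
`Coordinates.val_ne_el`; subgroups of finite index and a finite `I` give finite quotients.

* If the graph of groups is primitive, `L v = N ℤ²` is admissible for every `N`, and a given
  reduced word stays reduced modulo `N ℤ²` for large `N`. Hence primitive tubular groups, and with
  them virtually primitive groups, are residually finite.
* By the normal form theorem the vertex groups are their own centralizers, and the two vertex groups
  at an edge intersect in the edge group. Therefore an edge group is a centralizer, and centralizers
  in residually finite groups are separable.
* If the edge groups are separable, some normal subgroup of finite index meets the maximal
  cyclic subgroups that contain the edge groups only in the edge groups. Its intersections with the
  vertex groups are the subgroups `H v` of a regulating pair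
  (`IsTubular.exists_isRegulating_of_isSeparable`).
* Given a regulating pair, the finite representation with `L = H` and no prescribed word has the
  groups `H v` as point stabilizers in the vertex groups. The stabilizer of a point in
  the fundamental group is the fundamental group of a finite graph of groups with vertex groups
  `H v`, which is primitive. The isomorphism is `StabilizerData.exists_mulEquiv_piOne`: surjectivity
  holds because paths lift (`StabilizerData.lifts_of_isPath`), and injectivity because reduced words
  go to reduced words (`StabilizerData.reduced_mapWord`).
-/

namespace GraphOfGroups

/-! ### The path group -/

section PathGroup

variable {𝒢 : GraphOfGroups.{u}}

theorem letter_mul_ofV (e : 𝒢.E) (g : 𝒢.eGrp e) :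
    𝒢.letter e * 𝒢.ofV _ (𝒢.att e true g) = 𝒢.ofV _ (𝒢.att e false g) * 𝒢.letter e := by
  have h : (QuotientGroup.mk' (Subgroup.normalClosure 𝒢.pathRel))
      (Monoid.Coprod.inr (FreeGroup.of e) *
        Monoid.Coprod.inl (Monoid.CoprodI.of (𝒢.att e true g)) *
        (Monoid.Coprod.inr (FreeGroup.of e))⁻¹ *
        (Monoid.Coprod.inl (Monoid.CoprodI.of (𝒢.att e false g)))⁻¹) = 1 :=
    (QuotientGroup.eq_one_iff _).2 (Subgroup.subset_normalClosure ⟨e, g, rfl⟩)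
  rw [map_mul, mul_eq_one_iff_eq_inv, map_inv, inv_inv, map_mul, map_inv,
    mul_inv_eq_iff_eq_mul, map_mul] at h
  exact h

/-- The universal property of the path group. -/
theorem exists_pathGroup_hom {Q : Type*} [Group Q] (β : ∀ v, 𝒢.vGrp v →* Q) (τ : 𝒢.E → Q)
    (h : ∀ e g, τ e * β _ (𝒢.att e true g) = β _ (𝒢.att e false g) * τ e) :
    ∃ ρ : 𝒢.PathGroup →* Q,
      (∀ v g, ρ (𝒢.ofV v g) = β v g) ∧ ∀ e, ρ (𝒢.letter e) = τ e := by
  let f : 𝒢.PrePathGroup →* Q :=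
    Monoid.Coprod.lift (Monoid.CoprodI.lift β) (FreeGroup.lift τ)
  have hf : Subgroup.normalClosure 𝒢.pathRel ≤ f.ker := by
    refine Subgroup.normalClosure_le_normal ?_
    rintro _ ⟨e, g, rfl⟩
    simp [f, MonoidHom.mem_ker, h]
  refine ⟨QuotientGroup.lift _ f fun x hx => hf hx, fun v g => ?_, fun e => ?_⟩
  · simp [ofV, f]
  · simp [letter, f]

variable (𝒢) in
/-- The letter `t_e` if `s` is `true`, and `t_e⁻¹` if `s` is `false`; in both cases it is a path
that ends at `vert e s`. -/
def dirLetter (e : 𝒢.E) (s : Bool) : 𝒢.PathGroup :=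
  if s then 𝒢.letter e else (𝒢.letter e)⁻¹

theorem dirLetter_not (e : 𝒢.E) (s : Bool) : 𝒢.dirLetter e (!s) = (𝒢.dirLetter e s)⁻¹ := by
  cases s <;> simp [dirLetter]

theorem isPath_dirLetter (e : 𝒢.E) (s : Bool) :
    𝒢.IsPath (𝒢.vert e (!s)) (𝒢.vert e s) (𝒢.dirLetter e s) := by
  cases s
  · exact (IsPath.letter e).inv
  · exact IsPath.letter e

theorem dirLetter_mul_ofV (e : 𝒢.E) (s : Bool) (g : 𝒢.eGrp e) :
    𝒢.dirLetter e s * 𝒢.ofV _ (𝒢.att e s g) =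
      𝒢.ofV _ (𝒢.att e (!s) g) * 𝒢.dirLetter e s := by
  cases s
  · have := letter_mul_ofV e g
    simp only [dirLetter, Bool.false_eq_true, if_false]
    rw [eq_mul_inv_iff_mul_eq, mul_assoc, ← this, inv_mul_cancel_left, Bool.not_false]
  · exact letter_mul_ofV e g

theorem ofV_congr {v w : 𝒢.V} {g : 𝒢.vGrp v} {h : 𝒢.vGrp w}
    (H : (⟨v, g⟩ : Σ v, 𝒢.vGrp v) = ⟨w, h⟩) : 𝒢.ofV v g = 𝒢.ofV w h := by
  cases H; rfl

theorem IsPath.one (v : 𝒢.V) : 𝒢.IsPath v v 1 := by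
  simpa using IsPath.ofV (𝒢 := 𝒢) v 1

theorem Connected.exists_isPath (h : 𝒢.Connected) (v w : 𝒢.V) : ∃ x, 𝒢.IsPath v w x := by
  induction h.2 v w with
  | rel a b h => obtain ⟨e, rfl, rfl⟩ := h; exact ⟨_, IsPath.letter e⟩
  | refl a => exact ⟨1, IsPath.one a⟩
  | symm a b _ ih => obtain ⟨x, hx⟩ := ih; exact ⟨_, hx.inv⟩
  | trans a b c _ _ ih₁ ih₂ =>
    obtain ⟨x, hx⟩ := ih₁
    obtain ⟨y, hy⟩ := ih₂
    exact ⟨_, hx.mul hy⟩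

theorem IsPath.eqvGen {v w : 𝒢.V} {x : 𝒢.PathGroup} (h : 𝒢.IsPath v w x) :
    Relation.EqvGen (fun a b => ∃ e, 𝒢.vert e false = a ∧ 𝒢.vert e true = b) v w := by
  induction h with
  | ofV v g => exact .refl _
  | letter e => exact .rel _ _ ⟨e, rfl, rfl⟩
  | inv _ ih => exact .symm _ _ ih
  | mul _ _ ih₁ ih₂ => exact .trans _ _ _ ih₁ ih₂

/-- A rigid morphism is determined by combinatorial data: maps of the vertex groups and of the edge
groups that are compatible with the attaching maps extend to the path groups. -/
theorem exists_isRigid {ℋ : GraphOfGroups.{u}} (onV : 𝒢.V → ℋ.V) (onE : 𝒢.E → ℋ.E)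
    (rev : 𝒢.E → Bool) (homV : ∀ v, 𝒢.vGrp v →* ℋ.vGrp (onV v))
    (homE : ∀ e, 𝒢.eGrp e →* ℋ.eGrp (onE e))
    (comm : ∀ (e : 𝒢.E) (s : Bool) (g : 𝒢.eGrp e),
      (⟨onV (𝒢.vert e s), homV _ (𝒢.att e s g)⟩ : Σ w, ℋ.vGrp w) =
        ⟨ℋ.vert (onE e) (xor (rev e) s), ℋ.att (onE e) (xor (rev e) s) (homE e g)⟩)
    (hV : Function.Bijective onV) (hE : Function.Bijective onE)
    (hhV : ∀ v, Function.Injective (homV v)) (hhE : ∀ e, Function.Injective (homE e)) :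
    ∃ f : Morphism 𝒢 ℋ, f.IsRigid := by
  obtain ⟨ρ, hρ, hρ'⟩ := exists_pathGroup_hom (𝒢 := 𝒢) (fun v => (ℋ.ofV (onV v)).comp (homV v))
    (fun e => ℋ.dirLetter (onE e) (!(rev e))) (fun e g => by
      have h₁ := ofV_congr (comm e true g)
      have h₂ := ofV_congr (comm e false g)
      simp only [MonoidHom.comp_apply]
      rw [h₁, h₂]
      generalize rev e = r
      cases r <;> exact dirLetter_mul_ofV (onE e) _ (homE e g))
  refine ⟨⟨ρ, onV, onE, rev, homV, homE, comm, hρ, fun e => ?_⟩, hV, hE, hhV, hhE⟩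
  have h₁ := congrArg Sigma.fst (comm e true 1)
  have h₂ := congrArg Sigma.fst (comm e false 1)
  simp only [Bool.xor_true, Bool.xor_false] at h₁ h₂
  rw [hρ', h₁, h₂]
  simpa using isPath_dirLetter (onE e) (!(rev e))

end PathGroup

/-! ### Coordinates -/

/-- A choice of isomorphisms of the vertex groups with `ℤ²` and of the edge groups with `ℤ`. -/
structure Coordinates (𝒢 : GraphOfGroups.{u}) where
  cV : ∀ v, 𝒢.vGrp v ≃* Multiplicative (ℤ × ℤ)
  cE : ∀ e, 𝒢.eGrp e ≃* Multiplicative ℤ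

theorem IsTubular.nonempty_coordinates {𝒢 : GraphOfGroups.{u}} (h : 𝒢.IsTubular) :
    Nonempty 𝒢.Coordinates :=
  ⟨⟨fun v => (h.vGrp_equiv v).some, fun e => (h.eGrp_equiv e).some⟩⟩

namespace Coordinates

variable {𝒢 : GraphOfGroups.{u}} (C : 𝒢.Coordinates)

/-- The element of the path group given by a vector in the vertex group at `v`. -/
def el (v : 𝒢.V) (z : ℤ × ℤ) : 𝒢.PathGroup :=
  𝒢.ofV v ((C.cV v).symm (Multiplicative.ofAdd z))

/-- The image of the generator of the edge group of `e` in the vertex group at `vert e s`. -/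
def vec (e : 𝒢.E) (s : Bool) : ℤ × ℤ :=
  (C.cV _ (𝒢.att e s ((C.cE e).symm (Multiplicative.ofAdd 1)))).toAdd

@[simp] theorem el_zero (v : 𝒢.V) : C.el v 0 = 1 := by simp [el]

theorem el_add (v : 𝒢.V) (y z : ℤ × ℤ) : C.el v (y + z) = C.el v y * C.el v z := by simp [el]

theorem el_neg (v : 𝒢.V) (z : ℤ × ℤ) : C.el v (-z) = (C.el v z)⁻¹ := by simp [el]

theorem el_zsmul (v : 𝒢.V) (n : ℤ) (z : ℤ × ℤ) : C.el v (n • z) = C.el v z ^ n := by simp [el, -zsmul_eq_mul]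

theorem el_mul_comm (v : 𝒢.V) (y z : ℤ × ℤ) : C.el v y * C.el v z = C.el v z * C.el v y := by
  rw [← el_add, add_comm, el_add]

theorem ofV_eq_el (v : 𝒢.V) (g : 𝒢.vGrp v) : 𝒢.ofV v g = C.el v (C.cV v g).toAdd := by
  simp [el]

theorem isPath_el (v : 𝒢.V) (z : ℤ × ℤ) : 𝒢.IsPath v v (C.el v z) := IsPath.ofV _ _

theorem cV_att (e : 𝒢.E) (s : Bool) (g : 𝒢.eGrp e) :
    (C.cV _ (𝒢.att e s g)).toAdd = (C.cE e g).toAdd • C.vec e s := by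
  have : g = ((C.cE e).symm (Multiplicative.ofAdd 1)) ^ (C.cE e g).toAdd := by
    apply (C.cE e).injective
    simp only [map_zpow, MulEquiv.apply_symm_apply]
    simp [← ofAdd_zsmul]
  conv_lhs => rw [this]
  simp [vec]

theorem ofV_att (e : 𝒢.E) (s : Bool) (g : 𝒢.eGrp e) :
    𝒢.ofV _ (𝒢.att e s g) = C.el (𝒢.vert e s) ((C.cE e g).toAdd • C.vec e s) := by
  rw [C.ofV_eq_el, cV_att]

theorem el_zsmul_vec (e : 𝒢.E) (s : Bool) (n : ℤ) :
    C.el (𝒢.vert e s) (n • C.vec e s) = 𝒢.ofV _ (𝒢.att e s ((C.cE e).symm (Multiplicative.ofAdd n))) := by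
  simp [C.ofV_att, -zsmul_eq_mul]

theorem vec_ne_zero (e : 𝒢.E) (s : Bool) : C.vec e s ≠ 0 := by
  intro h
  have h1 : C.cV _ (𝒢.att e s ((C.cE e).symm (Multiplicative.ofAdd 1))) = 1 := h
  rw [map_eq_one_iff _ (C.cV _).injective, map_eq_one_iff _ (𝒢.att_injective e s),
    map_eq_one_iff _ (C.cE e).symm.injective] at h1
  exact one_ne_zero (α := ℤ) (congrArg Multiplicative.toAdd h1)

theorem dirLetter_mul_el (e : 𝒢.E) (s : Bool) (n : ℤ) :
    𝒢.dirLetter e s * C.el (𝒢.vert e s) (n • C.vec e s) =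
      C.el (𝒢.vert e (!s)) (n • C.vec e (!s)) * 𝒢.dirLetter e s := by
  rw [el_zsmul_vec, el_zsmul_vec, dirLetter_mul_ofV]

/-- The universal property of the path group, in coordinates. -/
theorem exists_hom {Q : Type*} [Group Q] (β : 𝒢.V → Multiplicative (ℤ × ℤ) →* Q) (τ : 𝒢.E → Q)
    (h : ∀ e, τ e * β (𝒢.vert e true) (Multiplicative.ofAdd (C.vec e true)) =
      β (𝒢.vert e false) (Multiplicative.ofAdd (C.vec e false)) * τ e) :
    ∃ ρ : 𝒢.PathGroup →* Q, (∀ v z, ρ (C.el v z) = β v (Multiplicative.ofAdd z)) ∧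
      ∀ e, ρ (𝒢.letter e) = τ e := by
  obtain ⟨ρ, h₁, h₂⟩ := exists_pathGroup_hom (𝒢 := 𝒢)
    (fun v => (β v).comp (C.cV v).toMonoidHom) τ (fun e g => by
      have key : ∀ s, C.cV _ (𝒢.att e s g) =
          (Multiplicative.ofAdd (C.vec e s)) ^ (C.cE e g).toAdd := fun s => C.cV_att e s g
      simp only [MonoidHom.comp_apply, MulEquiv.coe_toMonoidHom, key, map_zpow]
      exact ((show SemiconjBy (τ e) _ _ from h e).zpow_right _))
  exact ⟨ρ, fun v z => by simp [el, h₁], h₂⟩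

/-! ### Words -/

/-- The element `t₁ g₁ ⋯ tₙ gₙ` of the path group that is spelled by a word. The letter `(e, s, z)`
stands for the directed edge `e` with terminal vertex `vert e s`, followed by the vector `z` in the
vertex group at this vertex. -/
def val : List (𝒢.E × Bool × (ℤ × ℤ)) → 𝒢.PathGroup
  | [] => 1
  | (e, s, z) :: l => 𝒢.dirLetter e s * C.el (𝒢.vert e s) z * val l

/-- The directed edges of the word form an edge path from `v` to `w`. -/
def IsWord : 𝒢.V → List (𝒢.E × Bool × (ℤ × ℤ)) → 𝒢.V → Prop
  | v, [], w => v = w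
  | v, (e, s, _) :: l, w => 𝒢.vert e (!s) = v ∧ IsWord (𝒢.vert e s) l w

/-- The word contains no subword `t z t⁻¹` in which `z` belongs, modulo the subgroup `L`, to the
edge group at the end of the letter `t`. -/
def Reduced (L : 𝒢.V → AddSubgroup (ℤ × ℤ)) (l : List (𝒢.E × Bool × (ℤ × ℤ))) : Prop :=
  l.IsChain fun a b =>
    ¬ (b.1 = a.1 ∧ b.2.1 = !a.2.1 ∧ ∃ n : ℤ, a.2.2 - n • C.vec a.1 a.2.1 ∈ L (𝒢.vert a.1 a.2.1))

/-- A path can be written as a reduced word. -/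
def HasReducedWord (v w : 𝒢.V) (x : 𝒢.PathGroup) : Prop :=
  ∃ z l, IsWord v l w ∧ C.Reduced (fun _ => ⊥) l ∧ x = C.el v z * C.val l

theorem HasReducedWord.el_mul {v w : 𝒢.V} {x : 𝒢.PathGroup} (h : C.HasReducedWord v w x)
    (y : ℤ × ℤ) : C.HasReducedWord v w (C.el v y * x) := by
  obtain ⟨z, l, h₁, h₂, rfl⟩ := h
  exact ⟨y + z, l, h₁, h₂, by rw [el_add, mul_assoc]⟩

theorem HasReducedWord.dirLetter_mul (e : 𝒢.E) (s : Bool) {w : 𝒢.V} {x : 𝒢.PathGroup}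
    (h : C.HasReducedWord (𝒢.vert e s) w x) :
    C.HasReducedWord (𝒢.vert e (!s)) w (𝒢.dirLetter e s * x) := by
  obtain ⟨z, l, h₁, h₂, rfl⟩ := h
  by_cases hl : ∃ y l', ∃ n : ℤ, l = (e, !s, y) :: l' ∧ z = n • C.vec e s
  · obtain ⟨y, l', n, rfl, rfl⟩ := hl
    refine ⟨n • C.vec e (!s) + y, l', h₁.2, h₂.tail, ?_⟩
    rw [← mul_assoc, dirLetter_mul_el, val, dirLetter_not, el_add]
    group
  · refine ⟨0, (e, s, z) :: l, ⟨rfl, h₁⟩, ?_, by simp [val, mul_assoc]⟩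
    match l, h₁, h₂, hl with
    | [], _, _, _ => exact List.isChain_singleton _
    | (e', s', y) :: l', h₁, h₂, hl =>
      refine List.isChain_cons_cons.2 ⟨?_, h₂⟩
      rintro ⟨h, h', n, hn⟩
      simp only at h h' hn
      subst h h'
      exact hl ⟨y, l', n, rfl, sub_eq_zero.1 hn⟩

theorem hasReducedWord_of_isPath {v w : 𝒢.V} {x : 𝒢.PathGroup} (h : 𝒢.IsPath v w x) :
    C.HasReducedWord v w x := by
  -- reducibility to a word is preserved by left multiplication by paths and by their inverses
  have key : ∀ {v w x}, 𝒢.IsPath v w x → ∀ u y,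
      (C.HasReducedWord w u y → C.HasReducedWord v u (x * y)) ∧
      (C.HasReducedWord v u y → C.HasReducedWord w u (x⁻¹ * y)) := by
    intro v w x h
    induction h with
    | ofV v g =>
      intro u y
      rw [C.ofV_eq_el, ← C.el_neg]
      exact ⟨fun h => h.el_mul C _, fun h => h.el_mul C _⟩
    | letter e =>
      intro u y
      exact ⟨fun h => h.dirLetter_mul C e true, fun h => h.dirLetter_mul C e false⟩
    | inv _ ih =>
      intro u y
      rw [inv_inv]
      exact (ih u y).symm
    | mul _ _ ih₁ ih₂ =>
      intro u y
      rw [mul_inv_rev, mul_assoc, mul_assoc]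
      exact ⟨fun h => (ih₁ u _).1 ((ih₂ u y).1 h), fun h => (ih₂ u _).2 ((ih₁ u y).2 h)⟩
  have h1 : C.HasReducedWord w w 1 := ⟨0, [], rfl, List.isChain_nil, by simp [val]⟩
  simpa using (key h w 1).1 h1

/-- If `k` does not belong to the edge group at the start of the reduced word `l`, then
`l⁻¹ k m` is reduced. -/
theorem exists_reduced_inv_mul (l : List (𝒢.E × Bool × (ℤ × ℤ))) :
    ∀ (v w : 𝒢.V) (k : ℤ × ℤ) (m : List (𝒢.E × Bool × (ℤ × ℤ))), IsWord v l w →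
      C.Reduced (fun _ => ⊥) l → C.Reduced (fun _ => ⊥) m → m ≠ [] →
      (∀ e s z l', l = (e, s, z) :: l' → C.Reduced (fun _ => ⊥) ((e, !s, k) :: m)) →
      ∃ k' m', C.Reduced (fun _ => ⊥) m' ∧ m' ≠ [] ∧
        (C.val l)⁻¹ * C.el v k * C.val m = C.el w k' * C.val m' := by
  induction l with
  | nil =>
    rintro v w k m rfl - hm hm' -
    exact ⟨k, m, hm, hm', by simp [val]⟩
  | cons a l ih =>
    obtain ⟨e, s, z⟩ := a
    rintro v w k m ⟨rfl, hw⟩ hl hm hm' hj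
    obtain ⟨k', m', h₁, h₂, h₃⟩ := ih _ w (-z) ((e, !s, k) :: m) hw hl.tail (hj e s z l rfl)
      (List.cons_ne_nil _ _) (by
        rintro e₂ s₂ z₂ l' rfl
        refine List.isChain_cons_cons.2 ⟨?_, hj _ _ _ _ rfl⟩
        rintro ⟨h, h', n, hn⟩
        simp only at h h' hn
        subst h
        obtain rfl : s₂ = !s := by revert h'; cases s <;> cases s₂ <;> simp
        refine (List.isChain_cons_cons.1 hl).1 ⟨rfl, rfl, -n, ?_⟩
        rw [Bool.not_not] at hn
        rw [AddSubgroup.mem_bot] at hn ⊢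
        rw [← neg_eq_zero.2 hn]
        module)
    refine ⟨k', m', h₁, h₂, ?_⟩
    rw [← h₃, val, val, el_neg, dirLetter_not]
    group

end Coordinates
/-! ### Conjugating permutations with prescribed values -/

section Permutations

open Equiv Equiv.Perm

/-- Two permutations all of whose cycles have the same length are conjugate by a bijection that
maps given representatives of the cycles to given representatives. -/
theorem exists_equiv_conj {X Y : Type*} (σ : Perm X) (τ : Perm Y)
    (h : ∀ (n : ℤ) x y, (σ ^ n) x = x ↔ (τ ^ n) y = y)
    (β : Quotient (SameCycle.setoid σ) ≃ Quotient (SameCycle.setoid τ))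
    (r : Quotient (SameCycle.setoid σ) → X) (hr : ∀ ω, Quotient.mk _ (r ω) = ω)
    (r' : Quotient (SameCycle.setoid τ) → Y) (hr' : ∀ ω, Quotient.mk _ (r' ω) = ω) :
    ∃ t : X ≃ Y, (∀ x, t (σ x) = τ (t x)) ∧ ∀ ω, t (r ω) = r' (β ω) := by
  have h₁ : ∀ x, ∃ n : ℤ, (σ ^ n) (r (Quotient.mk _ x)) = x := fun x => Quotient.exact (hr _)
  have h₂ : ∀ y, ∃ n : ℤ, (τ ^ n) (r' (Quotient.mk _ y)) = y := fun y => Quotient.exact (hr' _)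
  choose n hn using h₁
  choose m hm using h₂
  let f : X → Y := fun x => (τ ^ n x) (r' (β (Quotient.mk _ x)))
  let g : Y → X := fun y => (σ ^ m y) (r (β.symm (Quotient.mk _ y)))
  have mk₁ : ∀ (k : ℤ) ω, (Quotient.mk (SameCycle.setoid σ) ((σ ^ k) (r ω))) = ω := fun k ω =>
    (Quotient.sound (SameCycle.symm ⟨k, rfl⟩)).trans (hr ω)
  have mk₂ : ∀ (k : ℤ) ω, (Quotient.mk (SameCycle.setoid τ) ((τ ^ k) (r' ω))) = ω := fun k ω =>
    (Quotient.sound (SameCycle.symm ⟨k, rfl⟩)).trans (hr' ω)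
  have hst : ∀ (k l : ℤ) x y, (σ ^ k) x = (σ ^ l) x ↔ (τ ^ k) y = (τ ^ l) y := by
    intro k l x y
    have := h (-l + k) x y
    rwa [zpow_add, zpow_add, Perm.mul_apply, Perm.mul_apply, zpow_neg, zpow_neg,
      Perm.inv_eq_iff_eq, Perm.inv_eq_iff_eq] at this
  have hf : ∀ (k : ℤ) ω, f ((σ ^ k) (r ω)) = (τ ^ k) (r' (β ω)) := by
    intro k ω
    have h1 := hn ((σ ^ k) (r ω))
    simp only [f]
    rw [mk₁] at h1 ⊢
    exact (hst _ _ _ _).1 h1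
  have hg : ∀ (k : ℤ) ω, g ((τ ^ k) (r' ω)) = (σ ^ k) (r (β.symm ω)) := by
    intro k ω
    have h1 := hm ((τ ^ k) (r' ω))
    simp only [g]
    rw [mk₂] at h1 ⊢
    exact (hst _ _ _ _).2 h1
  refine ⟨⟨f, g, fun x => ?_, fun y => ?_⟩, fun x => ?_, fun ω => hf 0 ω⟩
  · rw [← hn x, hf, hg, β.symm_apply_apply]
  · rw [← hm y, hg, hf, β.apply_symm_apply]
  · change f (σ x) = τ (f x)
    rw [← hn x, hf, ← Perm.mul_apply, ← Perm.mul_apply, ← zpow_one_add, ← zpow_one_add, hf]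

theorem exists_section_through {Z J : Type*} (s : Setoid Z) (f : J → Z)
    (hf : ∀ i j, s (f i) (f j) → i = j) :
    ∃ r : Quotient s → Z, (∀ ω, Quotient.mk _ (r ω) = ω) ∧
      ∀ j, r (Quotient.mk _ (f j)) = f j := by
  classical
  refine ⟨fun ω => if h : ∃ j, Quotient.mk s (f j) = ω then f h.choose else ω.out,
    fun ω => ?_, fun j => ?_⟩
  · by_cases h : ∃ j, Quotient.mk s (f j) = ω
    · simp only [dif_pos h]; exact h.choose_spec
    · simp only [dif_neg h]; exact ω.out_eq
  · have h : ∃ i, Quotient.mk s (f i) = Quotient.mk s (f j) := ⟨j, rfl⟩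
    simp only [dif_pos h]
    rw [hf _ _ (Quotient.exact h.choose_spec)]

/-- A bijection as in `exists_equiv_conj` can be prescribed at finitely many points, provided that
they belong to different cycles. -/
theorem exists_equiv_conj_extend {X Y J : Type*} [Finite J] (σ : Perm X) (τ : Perm Y)
    (h : ∀ (n : ℤ) x y, (σ ^ n) x = x ↔ (τ ^ n) y = y)
    (hβ : Nonempty (Quotient (SameCycle.setoid σ) ≃ Quotient (SameCycle.setoid τ)))
    (p : J → X) (q : J → Y) (hp : ∀ i j, SameCycle σ (p i) (p j) → i = j)
    (hq : ∀ i j, SameCycle τ (q i) (q j) → i = j) :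
    ∃ t : X ≃ Y, (∀ x, t (σ x) = τ (t x)) ∧ ∀ j, t (p j) = q j := by
  classical
  obtain ⟨r, hr, hrp⟩ := exists_section_through (SameCycle.setoid σ) p hp
  obtain ⟨r', hr', hrq⟩ := exists_section_through (SameCycle.setoid τ) q hq
  let P : J → Quotient (SameCycle.setoid σ) := fun j => Quotient.mk _ (p j)
  let Q : J → Quotient (SameCycle.setoid τ) := fun j => Quotient.mk _ (q j)
  have hP : Function.Injective P := fun i j hij => hp i j (Quotient.exact hij)
  have hQ : Function.Injective Q := fun i j hij => hq i j (Quotient.exact hij)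
  let f : Set.range P ↪ Quotient (SameCycle.setoid τ) :=
    ⟨fun x => Q ((Equiv.ofInjective P hP).symm x),
      hQ.comp (Equiv.ofInjective P hP).symm.injective⟩
  obtain ⟨β, hβ⟩ : ∃ β : Quotient (SameCycle.setoid σ) ≃ Quotient (SameCycle.setoid τ),
      ∀ x : Set.range P, β x = f x := by
    cases finite_or_infinite (Quotient (SameCycle.setoid σ))
    · exact Cardinal.extend_function_finite f hβ
    · refine Cardinal.extend_function_of_lt f ?_ hβ
      exact (Cardinal.lt_aleph0_of_finite _).trans_le (Cardinal.aleph0_le_mk _)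
  obtain ⟨t, ht, ht'⟩ := exists_equiv_conj σ τ h β r hr r' hr'
  refine ⟨t, ht, fun j => ?_⟩
  rw [← hrp j, ht', ← hrq j]
  congr 1
  have := hβ ⟨P j, j, rfl⟩
  simp only [f, Function.Embedding.coeFn_mk] at this
  rwa [show (⟨P j, j, rfl⟩ : Set.range P) = Equiv.ofInjective P hP j from rfl,
    Equiv.symm_apply_apply] at this

/-- The translations of the second coordinate, as permutations of `I × A`. -/
def translation (I A : Type*) [AddCommGroup A] : Multiplicative A →* Perm (I × A) where
  toFun a := ⟨fun x => (x.1, a.toAdd + x.2), fun x => (x.1, -a.toAdd + x.2),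
    fun x => by simp, fun x => by simp⟩
  map_one' := by ext x <;> simp
  map_mul' a b := by ext x <;> simp [add_assoc]

theorem translation_apply {I A : Type*} [AddCommGroup A] (a : Multiplicative A) (x : I × A) :
    translation I A a x = (x.1, a.toAdd + x.2) := rfl

theorem sameCycle_translation {I A : Type*} [AddCommGroup A] (a : A) (x y : I × A) :
    SameCycle (translation I A (Multiplicative.ofAdd a)) x y ↔
      x.1 = y.1 ∧ ∃ n : ℤ, n • a + x.2 = y.2 := by
  simp only [SameCycle, ← map_zpow, translation_apply, Prod.ext_iff, toAdd_zpow, toAdd_ofAdd,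
    exists_and_left]

theorem nonempty_equiv_cycles {I A : Type*} [AddCommGroup A] (a b : A)
    (hab : ∀ n : ℤ, n • a = 0 ↔ n • b = 0)
    (hfin : Finite A ∨ (Countable A ∧ Countable I ∧ Infinite I)) :
    Nonempty (Quotient (SameCycle.setoid (translation I A (Multiplicative.ofAdd a))) ≃
      Quotient (SameCycle.setoid (translation I A (Multiplicative.ofAdd b)))) := by
  have key : ∀ c : A, Nonempty
      (Quotient (SameCycle.setoid (translation I A (Multiplicative.ofAdd c))) ≃
        I × (A ⧸ AddSubgroup.zmultiples c)) := by
    intro c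
    have hiff : ∀ x y : I × A, (SameCycle.setoid (translation I A (Multiplicative.ofAdd c))) x y ↔
        ((x.1, (x.2 : A ⧸ AddSubgroup.zmultiples c)) : I × (A ⧸ AddSubgroup.zmultiples c)) =
          (y.1, (y.2 : A ⧸ AddSubgroup.zmultiples c)) := by
      intro x y
      refine (sameCycle_translation c x y).trans ?_
      rw [Prod.mk.injEq, QuotientAddGroup.eq, AddSubgroup.mem_zmultiples_iff]
      refine and_congr_right fun _ => exists_congr fun n => ?_
      rw [neg_add_eq_sub, eq_sub_iff_add_eq]
    refine ⟨Equiv.ofBijective (Quotient.lift _ fun x y h => (hiff x y).1 h) ⟨?_, ?_⟩⟩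
    · rintro ⟨x⟩ ⟨y⟩ hxy
      exact Quotient.sound ((hiff x y).2 hxy)
    · rintro ⟨i, ⟨x⟩⟩
      exact ⟨Quotient.mk _ (i, x), rfl⟩
  obtain ⟨ea⟩ := key a
  obtain ⟨eb⟩ := key b
  suffices Nonempty ((I × (A ⧸ AddSubgroup.zmultiples a)) ≃ (I × (A ⧸ AddSubgroup.zmultiples b))) from
    this.map fun e => ea.trans (e.trans eb.symm)
  rcases hfin with h | ⟨h₁, h₂, h₃⟩
  · have ha := AddSubgroup.card_eq_card_quotient_mul_card_addSubgroup (AddSubgroup.zmultiples a)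
    have hb := AddSubgroup.card_eq_card_quotient_mul_card_addSubgroup (AddSubgroup.zmultiples b)
    have hord : addOrderOf a = addOrderOf b := by
      refine addOrderOf_eq_addOrderOf_iff.2 fun n => ?_
      simpa using hab n
    rw [Nat.card_zmultiples] at ha hb
    rw [ha, hord] at hb
    have hcard := Nat.eq_of_mul_eq_mul_right (addOrderOf_pos b) hb
    exact (Finite.card_eq.1 hcard).map (Equiv.prodCongr (Equiv.refl I))
  · have : Countable (A ⧸ AddSubgroup.zmultiples a) := Quotient.countable
    have : Countable (A ⧸ AddSubgroup.zmultiples b) := Quotient.countable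
    exact nonempty_equiv_of_countable

end Permutations

/-! ### Permutation representations of the path group -/

namespace Coordinates

variable {𝒢 : GraphOfGroups.{u}} (C : 𝒢.Coordinates)

/-- The product over all vertices of the quotients of `ℤ²` by the subgroups `L v`. -/
abbrev QuotProd (L : 𝒢.V → AddSubgroup (ℤ × ℤ)) : Type u := ∀ v, (ℤ × ℤ) ⧸ L v

open Classical in
/-- The map of `ℤ²` to the factor of the vertex `v`. -/
noncomputable def toQuotProd (L : 𝒢.V → AddSubgroup (ℤ × ℤ)) (v : 𝒢.V) :
    ℤ × ℤ →+ QuotProd L :=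
  (AddMonoidHom.single (fun v => (ℤ × ℤ) ⧸ L v) v).comp (QuotientAddGroup.mk' (L v))

theorem toQuotProd_eq_zero (L : 𝒢.V → AddSubgroup (ℤ × ℤ)) (v : 𝒢.V) (z : ℤ × ℤ) :
    toQuotProd L v z = 0 ↔ z ∈ L v := by
  classical
  simp [toQuotProd, Pi.single_eq_zero_iff]

/-- The path group acts on `I × ∏ v, ℤ² / L v` in such a way that each vertex group acts by
translation of its factor, and that a given reduced word moves a point from one end to the other of
a chain of points whose `I`-coordinates are `lev n, …, lev 0`. The letter `t_e` has to act by a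
bijection that conjugates the two translations given by the ends of `e`; reducedness of the word
means that the values that are to be prescribed lie in different orbits. -/
theorem exists_hom_perm [Finite 𝒢.V] (L : 𝒢.V → AddSubgroup (ℤ × ℤ))
    (hL : ∀ e (n : ℤ), n • C.vec e true ∈ L (𝒢.vert e true) ↔
      n • C.vec e false ∈ L (𝒢.vert e false))
    (I : Type) (hfin : Finite (QuotProd L) ∨ (Countable I ∧ Infinite I))
    (l : List (𝒢.E × Bool × (ℤ × ℤ))) (hl : C.Reduced L l) (lev : ℕ → I)
    (hlev : ∀ i j, i ≤ l.length → j ≤ l.length → lev i = lev j → i = j) :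
    ∃ ρ : 𝒢.PathGroup →* Equiv.Perm (I × QuotProd L),
      (∀ v z x, ρ (C.el v z) x = (x.1, toQuotProd L v z + x.2)) ∧
      ρ (C.val l) (lev l.length, 0) = (lev 0, 0) := by
  classical
  let a : ∀ (_ : 𝒢.E) (_ : Bool), QuotProd L :=
    fun e s => toQuotProd L (𝒢.vert e s) (C.vec e s)
  let σ : ∀ (_ : 𝒢.E) (_ : Bool), Equiv.Perm (I × QuotProd L) :=
    fun e s => translation I (QuotProd L) (Multiplicative.ofAdd (a e s))
  have ha : ∀ e (n : ℤ), n • a e true = 0 ↔ n • a e false = 0 := by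
    intro e n
    simp only [a, ← map_zsmul, toQuotProd_eq_zero, hL]
  -- for the `i`-th letter, the point before the letter acts, or the point after
  let pt : ∀ (_ : Bool) (_ : Fin l.length), I × QuotProd L := fun s i =>
    if (l.get i).2.1 = s then
      (lev (i + 1), toQuotProd L (𝒢.vert (l.get i).1 (l.get i).2.1) (l.get i).2.2)
    else (lev i, 0)
  have hinj_lt : ∀ e s (i j : Fin l.length), (l.get i).1 = e → (l.get j).1 = e →
      i.1 + 1 = j.1 → (l.get i).2.1 = s → (l.get j).2.1 ≠ s →
      ∀ n : ℤ, n • a e s ≠ toQuotProd L (𝒢.vert e s) (l.get i).2.2 := by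
    intro e s i j hi hj hij hsi hsj n hn
    have hc := List.isChain_iff_getElem.1 hl i.1 (by omega)
    refine hc ⟨?_, ?_, n, ?_⟩
    · have : (l.get j).1 = (l.get i).1 := hj.trans hi.symm
      simpa [hij] using this
    · have : (l.get j).2.1 = !(l.get i).2.1 := by
        rw [hsi]; revert hsj; cases s <;> simp
      simpa [hij] using this
    · change (l.get i).2.2 - n • C.vec (l.get i).1 (l.get i).2.1 ∈
        L (𝒢.vert (l.get i).1 (l.get i).2.1)
      rw [hi, hsi, ← toQuotProd_eq_zero, map_sub, ← hn, map_zsmul, sub_self]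
  have hinj : ∀ e s (i j : {i : Fin l.length // (l.get i).1 = e}),
      (σ e s).SameCycle (pt s i) (pt s j) → i = j := by
    rintro e s ⟨i, hi⟩ ⟨j, hj⟩ h
    obtain ⟨h₁, n, h₂⟩ := (sameCycle_translation _ _ _).1 h
    have hi' := i.2
    have hj' := j.2
    simp only [pt] at h₁ h₂
    ext
    simp only
    by_cases hsi : (l.get i).2.1 = s <;> by_cases hsj : (l.get j).2.1 = s <;>
      simp only [hsi, hsj, if_true, if_false] at h₁ h₂ <;>
      have h₃ := hlev _ _ (by omega) (by omega) h₁
    · omega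
    · refine absurd ?_ (hinj_lt e s i j hi hj h₃ hsi hsj (-n))
      rw [hi] at h₂
      rw [neg_smul, neg_eq_iff_add_eq_zero, h₂]
    · refine absurd ?_ (hinj_lt e s j i hj hi h₃.symm hsj hsi n)
      rw [hj, add_zero] at h₂
      exact h₂
    · exact h₃
  have hτ : ∀ e, ∃ t : Equiv.Perm (I × QuotProd L), (∀ x, t (σ e true x) = σ e false (t x)) ∧
      ∀ j : {i : Fin l.length // (l.get i).1 = e}, t (pt true j) = pt false j := by
    intro e
    refine exists_equiv_conj_extend (σ e true) (σ e false) ?_ ?_ _ _ (hinj e true) (hinj e false)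
    · intro n x y
      simp only [σ, ← map_zpow, translation_apply, Prod.ext_iff, true_and, toAdd_zpow,
        toAdd_ofAdd, add_eq_right, ha]
    · have : ∀ v, Countable ((ℤ × ℤ) ⧸ L v) := fun v => Quotient.countable
      exact nonempty_equiv_cycles _ _ (ha e)
        (hfin.imp id fun h => ⟨inferInstanceAs (Countable (∀ v, (ℤ × ℤ) ⧸ L v)), h⟩)
  choose τ hτ₁ hτ₂ using hτ
  obtain ⟨ρ, hρ₁, hρ₂⟩ := C.exists_hom
    (fun v => (translation I (QuotProd L)).comp (toQuotProd L v).toMultiplicative) τ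
    (fun e => Equiv.ext (hτ₁ e))
  refine ⟨ρ, fun v z x => by rw [hρ₁]; rfl, ?_⟩
  have step : ∀ i : Fin l.length, ρ (𝒢.dirLetter (l.get i).1 (l.get i).2.1)
      (lev (i + 1), toQuotProd L (𝒢.vert (l.get i).1 (l.get i).2.1) (l.get i).2.2) =
        (lev i, 0) := by
    intro i
    have := hτ₂ _ ⟨i, rfl⟩
    simp only [pt] at this
    rcases hs : (l.get i).2.1 with _ | _
    · rw [hs] at this
      simp only [Bool.false_eq_true, if_false, if_true] at this
      rw [dirLetter, if_neg Bool.false_ne_true, map_inv, hρ₂, Equiv.Perm.inv_eq_iff_eq, this]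
    · rw [hs] at this
      simpa [dirLetter, hρ₂] using this
  have main : ∀ l₂ l₁, l = l₁ ++ l₂ → ρ (C.val l₂) (lev l.length, 0) = (lev l₁.length, 0) := by
    intro l₂
    induction l₂ with
    | nil => rintro l₁ h; simp [val, h]
    | cons b l₂ ih =>
      intro l₁ h
      obtain ⟨e, s, z⟩ := b
      have h₁ := ih (l₁ ++ [(e, s, z)]) (by simp [h])
      have h₂ := step ⟨l₁.length, by simp [h]⟩
      have h₃ : l.get ⟨l₁.length, by simp [h]⟩ = (e, s, z) := by simp [h]
      rw [h₃] at h₂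
      rw [val, map_mul, map_mul, Equiv.Perm.mul_apply, Equiv.Perm.mul_apply, h₁, hρ₁]
      simpa [translation_apply] using h₂
  simpa using main l [] rfl

/-- **Normal form theorem**: a nonempty reduced word does not represent an element of a vertex
group. -/
theorem val_ne_el [Finite 𝒢.V] {l : List (𝒢.E × Bool × (ℤ × ℤ))}
    (hl : C.Reduced (fun _ => ⊥) l) (hne : l ≠ []) (v : 𝒢.V) (z : ℤ × ℤ) :
    C.val l ≠ C.el v z := by
  obtain ⟨ρ, h₁, h₂⟩ := C.exists_hom_perm (fun _ => ⊥)
    (by simp [C.vec_ne_zero, -zsmul_eq_mul]) ℕ (.inr ⟨inferInstance, inferInstance⟩)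
    l hl id (by simp)
  intro h
  rw [h, h₁] at h₂
  exact hne (List.length_eq_zero_iff.1 (congrArg Prod.fst h₂))

theorem el_injective [Finite 𝒢.V] (v : 𝒢.V) : Function.Injective (C.el v) := by
  obtain ⟨ρ, h₁, h₂⟩ := C.exists_hom_perm (fun _ => ⊥)
    (by simp [C.vec_ne_zero, -zsmul_eq_mul]) ℕ (.inr ⟨inferInstance, inferInstance⟩)
    [] List.isChain_nil id (by simp)
  intro y z h
  have h₃ := h₁ v (y - z) (0, 0)
  rw [sub_eq_add_neg, el_add, h, el_neg, mul_inv_cancel, map_one, Equiv.Perm.one_apply,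
    Prod.mk.injEq, add_zero, ← sub_eq_add_neg] at h₃
  exact sub_eq_zero.1 ((toQuotProd_eq_zero (fun _ => ⊥) v _).1 h₃.2.symm)

/-- If the subgroups `L v` have finite index and meet the edge groups compatibly, then there is a
finite permutation representation in which all stabilizers in the vertex groups are the
subgroups `L v`, and which detects a given word that is reduced modulo `L`. -/
theorem exists_hom_perm_finite [Finite 𝒢.V] (L : 𝒢.V → AddSubgroup (ℤ × ℤ))
    (hL : ∀ e (n : ℤ), n • C.vec e true ∈ L (𝒢.vert e true) ↔
      n • C.vec e false ∈ L (𝒢.vert e false))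
    (hfin : ∀ v, (L v).FiniteIndex)
    (l : List (𝒢.E × Bool × (ℤ × ℤ))) (hl : C.Reduced L l) :
    ∃ (X : Type u) (_ : Finite X) (ρ : 𝒢.PathGroup →* Equiv.Perm X),
      (∀ v z x, ρ (C.el v z) x = x ↔ z ∈ L v) ∧
      ∃ x, l ≠ [] → ∀ v z, ρ (C.val l) x ≠ ρ (C.el v z) x := by
  have : ∀ v, Finite ((ℤ × ℤ) ⧸ L v) := fun v => AddSubgroup.finite_quotient_of_finiteIndex
  obtain ⟨ρ, h₁, h₂⟩ := C.exists_hom_perm L hL (Fin (l.length + 1)) (.inl inferInstance) l hl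
    (fun i => Fin.ofNat _ i) (by
      intro i j hi hj h
      have := congrArg Fin.val h
      simpa [Nat.mod_eq_of_lt (Nat.lt_succ_of_le hi), Nat.mod_eq_of_lt (Nat.lt_succ_of_le hj)]
        using this)
  refine ⟨_, inferInstance, ρ, fun v z x => ?_, (Fin.ofNat _ l.length, 0), fun hne v z h => ?_⟩
  · rw [h₁, ← toQuotProd_eq_zero]
    simp [Prod.ext_iff]
  · rw [h₁, h₂] at h
    have h' := congrArg (fun x => (Prod.fst x).val) h
    simp at h'
    exact hne (List.length_eq_zero_iff.1 h'.symm)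

end Coordinates
/-! ### Primitive vectors -/

section Lattice

/-- The determinant of two vectors. -/
def det (a b : ℤ × ℤ) : ℤ := a.1 * b.2 - a.2 * b.1

theorem exists_det_ne_zero {a : ℤ × ℤ} (ha : a ≠ 0) : det a (-a.2, a.1) ≠ 0 := by
  intro h
  apply ha
  simp only [det] at h
  ext
  · simp only [Prod.fst_zero]; nlinarith [sq_nonneg a.1, sq_nonneg a.2]
  · simp only [Prod.snd_zero]; nlinarith [sq_nonneg a.1, sq_nonneg a.2]

theorem det_smul_self (a : ℤ × ℤ) (n : ℤ) : det a (n • a) = 0 := by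
  simp [det]; ring

theorem finiteIndex_of_smul_mem {L : AddSubgroup (ℤ × ℤ)} {N : ℤ} (hN : N ≠ 0)
    (h : ∀ z, N • z ∈ L) : L.FiniteIndex := by
  have : Finite ((ℤ × ℤ) ⧸ L) := by
    refine AddCommGroup.finite_of_fg_isAddTorsion _ ?_
    rintro ⟨z⟩
    refine isOfFinAddOrder_iff_zsmul_eq_zero.2 ⟨N, hN, ?_⟩
    exact (QuotientAddGroup.eq_zero_iff _).2 (h z)
  exact AddSubgroup.finiteIndex_of_finite_quotient

/-- A vector is primitive if it is not a proper multiple. -/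
def PrimitiveVec (a : ℤ × ℤ) : Prop := ∀ (y : ℤ × ℤ) (n : ℤ), n • y = a → n = 1 ∨ n = -1

theorem PrimitiveVec.isCoprime {a : ℤ × ℤ} (ha : PrimitiveVec a) : IsCoprime a.1 a.2 := by
  have h := ha (a.1 / (Int.gcd a.1 a.2 : ℤ), a.2 / (Int.gcd a.1 a.2 : ℤ)) (Int.gcd a.1 a.2) (by
    ext
    · simp [Int.mul_ediv_cancel' (Int.gcd_dvd_left _ _)]
    · simp [Int.mul_ediv_cancel' (Int.gcd_dvd_right _ _)])
  rw [Int.isCoprime_iff_gcd_eq_one]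
  omega

theorem PrimitiveVec.exists_smul_eq {a b : ℤ × ℤ} (ha : PrimitiveVec a) (h : det a b = 0) :
    ∃ n : ℤ, b = n • a := by
  obtain ⟨x, y, hxy⟩ := ha.isCoprime
  simp only [det] at h
  refine ⟨x * b.1 + y * b.2, ?_⟩
  ext
  · simp only [Prod.smul_fst, smul_eq_mul]; linear_combination -b.1 * hxy - y * h
  · simp only [Prod.smul_snd, smul_eq_mul]; linear_combination -b.2 * hxy + x * h

/-- The vectors all of whose coordinates are divisible by `N`. -/
def multiples (N : ℤ) : AddSubgroup (ℤ × ℤ) :=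
  (AddSubgroup.zmultiples N).prod (AddSubgroup.zmultiples N)

theorem mem_multiples {N : ℤ} {z : ℤ × ℤ} : z ∈ multiples N ↔ N ∣ z.1 ∧ N ∣ z.2 := by
  simp [multiples, AddSubgroup.mem_prod, Int.mem_zmultiples_iff]

theorem finiteIndex_multiples {N : ℤ} (hN : N ≠ 0) : (multiples N).FiniteIndex :=
  finiteIndex_of_smul_mem hN fun z => mem_multiples.2 ⟨by simp, by simp⟩

theorem PrimitiveVec.smul_mem_multiples {a : ℤ × ℤ} (ha : PrimitiveVec a) {N n : ℤ} :
    n • a ∈ multiples N ↔ N ∣ n := by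
  rw [mem_multiples]
  refine ⟨fun ⟨h₁, h₂⟩ => ?_, fun h => ⟨?_, ?_⟩⟩
  · obtain ⟨x, y, hxy⟩ := ha.isCoprime
    have : n = x * (n • a).1 + y * (n • a).2 := by
      simp only [Prod.smul_fst, Prod.smul_snd, smul_eq_mul]; linear_combination -n * hxy
    rw [this]
    exact dvd_add (h₁.mul_left _) (h₂.mul_left _)
  · simpa using h.mul_right _
  · simpa using h.mul_right _

end Lattice

/-! ### Residual finiteness and centralizers -/

theorem maximal_isCyclic_zpowers_iff {A : Type*} [Group A] {x : A}
    (hx : ∀ n : ℤ, x ^ n = 1 → n = 0) :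
    Maximal (fun K : Subgroup A => IsCyclic K) (Subgroup.zpowers x) ↔
      ∀ (y : A) (n : ℤ), y ^ n = x → n = 1 ∨ n = -1 := by
  constructor
  · intro h y n hy
    have hle : Subgroup.zpowers x ≤ Subgroup.zpowers y := by
      rw [Subgroup.zpowers_le]; exact ⟨n, hy⟩
    obtain ⟨m, hm⟩ := h.2 (inferInstance : IsCyclic (Subgroup.zpowers y)) hle
      (Subgroup.mem_zpowers y)
    simp only at hm
    have h1 : x ^ (m * n - 1) = 1 := by
      rw [zpow_sub_one, zpow_mul, hm, hy, mul_inv_cancel]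
    have h2 := hx _ h1
    have h3 : n * m = 1 := by linarith
    exact Int.eq_one_or_neg_one_of_mul_eq_one h3
  · refine fun h => ⟨(inferInstance : IsCyclic (Subgroup.zpowers x)), fun K hK hle => ?_⟩
    obtain ⟨y, rfl⟩ := (Subgroup.isCyclic_iff_exists_zpowers_eq_top K).1 hK
    obtain ⟨n, hn⟩ := hle (Subgroup.mem_zpowers x)
    simp only at hn
    rcases h y n hn with rfl | rfl
    · rw [zpow_one] at hn; rw [hn]
    · rw [← hn, Subgroup.zpowers_le]; exact ⟨-1, by simp⟩

namespace Coordinates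

variable {𝒢 : GraphOfGroups.{u}} (C : 𝒢.Coordinates)

/-- The generator of the edge group of `e` that is given by the coordinates. -/
def gen (e : 𝒢.E) : 𝒢.eGrp e := (C.cE e).symm (Multiplicative.ofAdd 1)

theorem eq_gen_zpow (e : 𝒢.E) (g : 𝒢.eGrp e) : g = C.gen e ^ (C.cE e g).toAdd := by
  apply (C.cE e).injective
  simp only [map_zpow, gen, MulEquiv.apply_symm_apply]
  simp [← ofAdd_zsmul]

theorem gen_zpow_eq_one {e : 𝒢.E} {n : ℤ} (h : C.gen e ^ n = 1) : n = 0 := by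
  have := congrArg (fun g => (C.cE e g).toAdd) h
  simpa [gen] using this

theorem cV_att_gen (e : 𝒢.E) (s : Bool) :
    C.cV _ (𝒢.att e s (C.gen e)) = Multiplicative.ofAdd (C.vec e s) := rfl

theorem att_gen_zpow_eq_one {e : 𝒢.E} {s : Bool} {n : ℤ} (h : 𝒢.att e s (C.gen e) ^ n = 1) :
    n = 0 := by
  rw [← map_zpow, map_eq_one_iff _ (𝒢.att_injective e s)] at h
  exact C.gen_zpow_eq_one h

theorem range_att (e : 𝒢.E) (s : Bool) :
    (𝒢.att e s).range = Subgroup.zpowers (𝒢.att e s (C.gen e)) := by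
  ext x
  constructor
  · rintro ⟨g, rfl⟩
    rw [C.eq_gen_zpow e g, map_zpow]
    exact Subgroup.zpow_mem _ (Subgroup.mem_zpowers _) _
  · rintro ⟨n, rfl⟩
    exact ⟨C.gen e ^ n, map_zpow _ _ _⟩

theorem isPrimitive_iff : 𝒢.IsPrimitive ↔ ∀ e s (y : 𝒢.vGrp (𝒢.vert e s)) (n : ℤ),
    y ^ n = 𝒢.att e s (C.gen e) → n = 1 ∨ n = -1 := by
  unfold IsPrimitive
  refine forall_congr' fun e => forall_congr' fun s => ?_
  rw [C.range_att, maximal_isCyclic_zpowers_iff fun n => C.att_gen_zpow_eq_one]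

theorem primitiveVec_of_isPrimitive (h : 𝒢.IsPrimitive) (e : 𝒢.E) (s : Bool) :
    PrimitiveVec (C.vec e s) := by
  intro y n hy
  refine C.isPrimitive_iff.1 h e s ((C.cV _).symm (Multiplicative.ofAdd y)) n ?_
  apply (C.cV _).injective
  rw [cV_att_gen, ← hy]
  simp [-zsmul_eq_mul]

/-- A nontrivial closed path in a primitive tubular graph of groups is detected by a finite
permutation representation in which the vertex groups act through their quotients by a suitable
`N ℤ²`. -/
theorem exists_finite_hom_ne_one (C : 𝒢.Coordinates) [Finite 𝒢.V] (hprim : 𝒢.IsPrimitive) {v : 𝒢.V}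
    {x : 𝒢.PathGroup} (hx : 𝒢.IsPath v v x) (hx1 : x ≠ 1) :
    ∃ (X : Type u) (_ : Finite X) (ρ : 𝒢.PathGroup →* Equiv.Perm X), ρ x ≠ 1 := by
  obtain ⟨z, l, -, hl, rfl⟩ := C.hasReducedWord_of_isPath hx
  have hp := C.primitiveVec_of_isPrimitive hprim
  -- `N` is larger than every number that has to remain nonzero modulo `N`
  let D : 𝒢.E × Bool × (ℤ × ℤ) → ℤ := fun a => |det (C.vec a.1 a.2.1) a.2.2|
  have hD : ∀ a, 0 ≤ D a := fun a => abs_nonneg _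
  let N : ℤ := 1 + |z.1| + |z.2| + (l.map D).sum
  have hDl : ∀ d ∈ l.map D, 0 ≤ d := by
    intro d hd
    obtain ⟨a, -, rfl⟩ := List.mem_map.1 hd
    exact hD a
  have hsum : 0 ≤ (l.map D).sum := List.sum_nonneg hDl
  have hz₁ : |z.1| < N := by have := abs_nonneg z.2; simp only [N]; omega
  have hz₂ : |z.2| < N := by have := abs_nonneg z.1; simp only [N]; omega
  have hN : ∀ a ∈ l, D a < N := by
    intro a ha
    have h₁ : D a ≤ (l.map D).sum :=
      List.single_le_sum hDl _ (List.mem_map_of_mem ha)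
    have := abs_nonneg z.1
    have := abs_nonneg z.2
    simp only [N]; omega
  have hN0 : N ≠ 0 := by have := abs_nonneg z.1; omega
  have hl' : C.Reduced (fun _ => multiples N) l := by
    refine List.IsChain.imp_of_mem_imp ?_ hl
    rintro a b ha - hab ⟨h₁, h₂, n, hn⟩
    refine hab ⟨h₁, h₂, ?_⟩
    have hdvd : N ∣ det (C.vec a.1 a.2.1) a.2.2 := by
      obtain ⟨⟨p, hp⟩, ⟨q, hq⟩⟩ := mem_multiples.1 hn
      refine ⟨det (C.vec a.1 a.2.1) (p, q), ?_⟩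
      simp only [Prod.fst_sub, Prod.snd_sub, Prod.smul_fst, Prod.smul_snd, smul_eq_mul] at hp hq
      simp only [det]
      linear_combination (C.vec a.1 a.2.1).1 * hq - (C.vec a.1 a.2.1).2 * hp
    obtain ⟨m, hm⟩ := (hp a.1 a.2.1).exists_smul_eq
      (Int.eq_zero_of_abs_lt_dvd hdvd (hN a ha))
    exact ⟨m, by simp [hm]⟩
  obtain ⟨X, hX, ρ, hρ, x, hx⟩ := C.exists_hom_perm_finite (fun _ => multiples N)
    (fun e n => by rw [(hp e true).smul_mem_multiples, (hp e false).smul_mem_multiples])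
    (fun _ => finiteIndex_multiples hN0) l hl'
  refine ⟨X, hX, ρ, fun h => ?_⟩
  by_cases hl0 : l = []
  · subst hl0
    have hz := (hρ v z x).1 (by rw [val, mul_one] at h; rw [h]; rfl)
    obtain ⟨h₁, h₂⟩ := mem_multiples.1 hz
    apply hx1
    rw [show z = 0 from Prod.ext (Int.eq_zero_of_abs_lt_dvd h₁ hz₁)
      (Int.eq_zero_of_abs_lt_dvd h₂ hz₂)]
    simp [val]
  · refine hx hl0 v (-z) ?_
    rw [el_neg, map_inv]
    rw [map_mul, mul_eq_one_iff_inv_eq] at h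
    rw [h]

/-- The centralizer of a vertex group is the vertex group. -/
theorem exists_eq_el_of_commute [Finite 𝒢.V] {v : 𝒢.V} {x : 𝒢.PathGroup} (hx : 𝒢.IsPath v v x)
    (hcomm : ∀ z, x * C.el v z = C.el v z * x) : ∃ z, x = C.el v z := by
  obtain ⟨z, l, hw, hl, rfl⟩ := C.hasReducedWord_of_isPath hx
  by_cases hl0 : l = []
  · subst hl0; exact ⟨z, by simp [val]⟩
  exfalso
  obtain ⟨⟨e, s, y⟩, l', rfl⟩ := List.exists_cons_of_ne_nil hl0
  -- conjugating an element that is not in the first edge group gives a nonempty reduced word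
  obtain ⟨h, hh⟩ : ∃ h, det (C.vec e (!s)) h ≠ 0 := ⟨_, exists_det_ne_zero (C.vec_ne_zero e (!s))⟩
  obtain ⟨k', m', h₁, h₂, h₃⟩ := C.exists_reduced_inv_mul _ v v h _ hw hl hl hl0 (by
    rintro e' s' y' l'' heq
    simp only [List.cons.injEq, Prod.mk.injEq] at heq
    obtain ⟨⟨rfl, rfl, rfl⟩, rfl⟩ := heq
    refine List.isChain_cons_cons.2 ⟨?_, hl⟩
    rintro ⟨-, -, n, hn⟩
    rw [AddSubgroup.mem_bot, sub_eq_zero] at hn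
    simp only at hn
    rw [hn] at hh
    exact hh (det_smul_self _ _))
  have h₄ := hcomm h
  rw [mul_assoc, ← mul_assoc (C.el v h), C.el_mul_comm v h z, mul_assoc, mul_left_cancel_iff] at h₄
  rw [mul_assoc, ← h₄, inv_mul_cancel_left] at h₃
  refine C.val_ne_el h₁ h₂ v (-k' + h) ?_
  rw [el_add, el_neg, h₃, inv_mul_cancel_left]

/-- The intersection of the vertex groups at the two ends of an edge is the edge group. -/
theorem exists_eq_smul_vec [Finite 𝒢.V] {e : 𝒢.E} {y z : ℤ × ℤ}
    (h : 𝒢.letter e * C.el (𝒢.vert e true) y = C.el (𝒢.vert e false) z * 𝒢.letter e) : ∃ n : ℤ, z = n • C.vec e false := by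
  by_cases hy : ∃ n : ℤ, y = n • C.vec e true
  · obtain ⟨n, rfl⟩ := hy
    have h₁ := C.dirLetter_mul_el e true n
    simp only [dirLetter, if_true, Bool.not_true] at h₁
    rw [h₁, mul_left_inj] at h
    exact ⟨n, (C.el_injective _ h).symm⟩
  · exfalso
    refine C.val_ne_el (l := [(e, true, y), (e, false, 0)]) ?_ (List.cons_ne_nil _ _)
      (𝒢.vert e false) z ?_
    · refine List.isChain_cons_cons.2 ⟨?_, List.isChain_singleton _⟩
      rintro ⟨-, -, n, hn⟩
      exact hy ⟨n, sub_eq_zero.1 hn⟩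
    · simp [val, dirLetter, h]

theorem mem_edgeSubgroup {v : 𝒢.V} {e : 𝒢.E} {p : 𝒢.PathGroup} {x : 𝒢.piOne v} :
    x ∈ 𝒢.edgeSubgroup v e p ↔
      ∃ n : ℤ, (x : 𝒢.PathGroup) = p * C.el (𝒢.vert e false) (n • C.vec e false) * p⁻¹ := by
  simp only [edgeSubgroup, Subgroup.mem_subgroupOf, Subgroup.mem_map, MonoidHom.mem_range,
    MonoidHom.comp_apply, MulEquiv.coe_toMonoidHom, MulAut.conj_apply, exists_exists_eq_and]
  constructor
  · rintro ⟨g, hg⟩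
    exact ⟨_, by rw [← hg, C.ofV_att]⟩
  · rintro ⟨n, hn⟩
    exact ⟨_, by rw [hn, el_zsmul_vec]⟩

end Coordinates

theorem IsTubular.residuallyFinite_of_isPrimitive {𝒢 : GraphOfGroups.{u}} (h : 𝒢.IsTubular)
    (hprim : 𝒢.IsPrimitive) (v : 𝒢.V) : Group.ResiduallyFinite (𝒢.piOne v) := by
  obtain ⟨C⟩ := h.nonempty_coordinates
  have := h.finite_V
  refine Group.residuallyFinite_iff_exists_finiteIndex.2 fun x hx => ?_
  obtain ⟨X, hX, ρ, hρ⟩ := C.exists_finite_hom_ne_one hprim x.2 (by simpa using hx)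
  exact ⟨(ρ.comp (𝒢.piOne v).subtype).ker, inferInstance, hρ⟩

theorem residuallyFinite_of_finiteIndex {G : Type*} [Group G] (H : Subgroup G) [H.FiniteIndex]
    [Group.ResiduallyFinite H] : Group.ResiduallyFinite G := by
  refine Group.residuallyFinite_iff_exists_finiteIndex.2 fun x hx => ?_
  by_cases hxH : x ∈ H
  · obtain ⟨K, hK, hxK⟩ := Group.residuallyFinite_iff_exists_finiteIndex.1
      ‹Group.ResiduallyFinite H› ⟨x, hxH⟩ (by simpa using hx)
    refine ⟨K.map H.subtype, ⟨?_⟩, ?_⟩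
    · rw [Subgroup.index_map_subtype]
      exact mul_ne_zero hK.index_ne_zero (Subgroup.FiniteIndex.index_ne_zero)
    · rintro ⟨y, hy, rfl⟩
      exact hxK hy
  · exact ⟨H, inferInstance, hxH⟩

theorem finiteIndex_comap {G H : Type*} [Group G] [Group H] (f : G →* H) (K : Subgroup H)
    [hK : K.FiniteIndex] : (K.comap f).FiniteIndex := by
  refine ⟨?_⟩
  have := K.isFiniteRelIndex_of_finiteIndex (K := f.range)
  rw [Subgroup.index_comap]
  exact Subgroup.relIndex_ne_zero

theorem residuallyFinite_of_injective {G H : Type*} [Group G] [Group H] [Group.ResiduallyFinite H]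
    (f : G →* H) (hf : Function.Injective f) : Group.ResiduallyFinite G := by
  refine Group.residuallyFinite_iff_exists_finiteIndex.2 fun x hx => ?_
  obtain ⟨K, hK, hxK⟩ := Group.residuallyFinite_iff_exists_finiteIndex.1
    ‹Group.ResiduallyFinite H› (f x) (by rwa [Ne, map_eq_one_iff f hf])
  exact ⟨K.comap f, finiteIndex_comap f K, hxK⟩

theorem residuallyFinite_of_isVirtuallyPrimitive {G : Type u} [Group G]
    (h : IsVirtuallyPrimitive G) : Group.ResiduallyFinite G := by
  obtain ⟨H, hH, 𝒦, h₁, h₂, w, ⟨φ⟩⟩ := h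
  have := h₁.residuallyFinite_of_isPrimitive h₂ w
  have : Group.ResiduallyFinite H := residuallyFinite_of_injective φ.toMonoidHom φ.injective
  exact residuallyFinite_of_finiteIndex H

open scoped commutatorElement in
/-- In a residually finite group every centralizer is separable. -/
theorem isSeparableSubgroup_of_centralizer {G : Type*} [Group G] [Group.ResiduallyFinite G]
    (T : Set G) : IsSeparableSubgroup (Subgroup.centralizer T) := by
  refine ⟨{K | K.FiniteIndex ∧ Subgroup.centralizer T ≤ K}, fun K hK => hK.1,
    le_antisymm (le_sInf fun K hK => hK.2) fun x hx => ?_⟩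
  rw [Subgroup.mem_centralizer_iff]
  intro y hy
  by_contra hne
  obtain ⟨N, hN⟩ := Group.exists_finiteIndexNormalSubgroup_notMem ⁅y, x⁆
    (fun h => hne (commutatorElement_eq_one_iff_mul_comm.1 h))
  let π := QuotientGroup.mk' N.toSubgroup
  have hfin : (Subgroup.comap π (Subgroup.centralizer {π y})).FiniteIndex :=
    finiteIndex_comap _ _
  have hmem := Subgroup.mem_sInf.1 hx (Subgroup.comap π (Subgroup.centralizer {π y}))
    ⟨hfin, fun z hz => ?_⟩
  · rw [Subgroup.mem_comap, Subgroup.mem_centralizer_singleton_iff] at hmem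
    apply hN
    change ⁅y, x⁆ ∈ N.toSubgroup
    rw [← QuotientGroup.eq_one_iff]
    change π ⁅y, x⁆ = 1
    rw [map_commutatorElement, commutatorElement_eq_one_iff_mul_comm, hmem]
  · rw [Subgroup.mem_comap, Subgroup.mem_centralizer_singleton_iff, ← map_mul, ← map_mul,
      Subgroup.mem_centralizer_iff.1 hz y hy]

theorem IsTubular.isSeparableSubgroup_edgeSubgroup {𝒢 : GraphOfGroups.{u}} (h : 𝒢.IsTubular)
    {v : 𝒢.V} (hRF : Group.ResiduallyFinite (𝒢.piOne v)) (e : 𝒢.E) (p : 𝒢.PathGroup)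
    (hp : 𝒢.IsPath v (𝒢.vert e false) p) : IsSeparableSubgroup (𝒢.edgeSubgroup v e p) := by
  obtain ⟨C⟩ := h.nonempty_coordinates
  have := h.finite_V
  let q := p * 𝒢.letter e
  have hq : 𝒢.IsPath v (𝒢.vert e true) q := hp.mul (.letter e)
  let T : Set (𝒢.piOne v) := {x | (∃ z, (x : 𝒢.PathGroup) = p * C.el (𝒢.vert e false) z * p⁻¹) ∨
    ∃ z, (x : 𝒢.PathGroup) = q * C.el (𝒢.vert e true) z * q⁻¹}
  have key : 𝒢.edgeSubgroup v e p = Subgroup.centralizer T := by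
    ext x
    rw [C.mem_edgeSubgroup, Subgroup.mem_centralizer_iff]
    constructor
    · rintro ⟨n, hn⟩ y hy
      have h₁ := C.dirLetter_mul_el e true n
      simp only [dirLetter, if_true, Bool.not_true] at h₁
      have hn' : (x : 𝒢.PathGroup) = q * C.el (𝒢.vert e true) (n • C.vec e true) * q⁻¹ := by
        rw [hn, mul_assoc p (𝒢.letter e), h₁]; simp only [q]; group
      apply Subtype.ext
      rw [Subgroup.coe_mul, Subgroup.coe_mul]
      rcases hy with ⟨z, hz⟩ | ⟨z, hz⟩
      · have := C.el_mul_comm (𝒢.vert e false) z (n • C.vec e false)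
        rw [hz, hn]
        simp only [mul_assoc, inv_mul_cancel_left, mul_right_inj]
        rw [← mul_assoc, this, mul_assoc]
      · have := C.el_mul_comm (𝒢.vert e true) z (n • C.vec e true)
        rw [hz, hn']
        simp only [mul_assoc, inv_mul_cancel_left, mul_right_inj]
        rw [← mul_assoc, this, mul_assoc]
    · intro hx
      have hcomm : ∀ {w} {r : 𝒢.PathGroup} (hr : 𝒢.IsPath v w r),
          (∀ z (y : 𝒢.piOne v), (y : 𝒢.PathGroup) = r * C.el w z * r⁻¹ → y ∈ T) →
          ∃ z, r⁻¹ * x * r = C.el w z := by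
        intro w r hr hT
        refine C.exists_eq_el_of_commute ((hr.inv.mul x.2).mul hr) fun z => ?_
        have h₁ := hx ⟨r * C.el w z * r⁻¹, (hr.mul (C.isPath_el w z)).mul hr.inv⟩ (hT z _ rfl)
        have h₂ := congrArg (fun y : 𝒢.piOne v => r⁻¹ * (y : 𝒢.PathGroup) * r) h₁
        simp only [Subgroup.coe_mul, mul_assoc, inv_mul_cancel_left, inv_mul_cancel, mul_one] at h₂
        simp only [mul_assoc]
        exact h₂.symm
      obtain ⟨z, hz⟩ := hcomm hp fun z y hy => .inl ⟨z, hy⟩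
      obtain ⟨y, hy⟩ := hcomm hq fun z y hy => .inr ⟨z, hy⟩
      obtain ⟨n, rfl⟩ := C.exists_eq_smul_vec (e := e) (y := y) (z := z) (by
        rw [← hz, ← hy]; simp only [q]; group)
      exact ⟨n, by rw [← hz]; group⟩
  rw [key]
  exact isSeparableSubgroup_of_centralizer T

/-! ### Rigid morphisms can be reversed -/

/-- Cramer's rule. -/
theorem det_smul_eq (a b z : ℤ × ℤ) : det a b • z = det z b • a + det a z • b := by
  ext <;> simp [det] <;> ring

theorem exists_pow_mem_range_of_injective {A B : Type*} [Group A] [Group B]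
    (ea : A ≃* Multiplicative (ℤ × ℤ)) (eb : B ≃* Multiplicative (ℤ × ℤ)) (f : A →* B)
    (hf : Function.Injective f) : ∃ N : ℕ, N ≠ 0 ∧ ∀ b, b ^ N ∈ f.range := by
  let φ : ℤ × ℤ → ℤ × ℤ := fun z => (eb (f (ea.symm (Multiplicative.ofAdd z)))).toAdd
  have hφ : Function.Injective φ := fun y z h => by simpa [φ, hf.eq_iff] using h
  have hadd : ∀ (m n : ℤ) y z, φ (m • y + n • z) = m • φ y + n • φ z := by
    intro m n y z
    simp [φ, -zsmul_eq_mul]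
  have hz : φ 0 = 0 := by simp [φ]
  let a := φ (1, 0)
  let b := φ (0, 1)
  have hab : ∀ m n : ℤ, φ (m, n) = m • a + n • b := by
    intro m n
    rw [← hadd]; congr 1; ext <;> simp
  have hD : det a b ≠ 0 := by
    intro h
    have h₁ : ∀ m n : ℤ, m • a + n • b = 0 → n = 0 := fun m n h => by
      rw [← hab, ← hz] at h; exact congrArg Prod.snd (hφ h)
    have h₃ := h₁ (det b (0, 1)) (-det a (0, 1)) (by
      have := h; simp only [det] at this ⊢; ext <;> simp <;> linarith)
    have h₄ := h₁ (det b (1, 0)) (-det a (1, 0)) (by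
      have := h; simp only [det] at this ⊢; ext <;> simp <;> linarith)
    have h₅ := h₁ 0 1
    have h₆ : a = 0 := by
      simp [det] at h₃ h₄
      ext <;> simp [h₃, h₄]
    have h₇ : φ (1, 0) = φ 0 := by rw [hz]; exact h₆
    simpa using congrArg Prod.fst (hφ h₇)
  have key : ∀ z, det a b • z = φ (det z b, det a z) := fun z => by rw [hab, det_smul_eq]
  refine ⟨(det a b).natAbs, by simpa using hD, fun y => ?_⟩
  have h₁ : y ^ (det a b) ∈ f.range := by
    refine ⟨ea.symm (Multiplicative.ofAdd (det (eb y).toAdd b, det a (eb y).toAdd)), ?_⟩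
    apply eb.injective
    have := (key (eb y).toAdd).symm
    rw [map_zpow]
    exact this
  rcases Int.natAbs_eq (det a b) with h | h
  · rwa [h, zpow_natCast] at h₁
  · rwa [h, zpow_neg, inv_mem_iff, zpow_natCast] at h₁

theorem exists_pow_mem_range_of_injective_int {A B : Type*} [Group A] [Group B]
    (ea : A ≃* Multiplicative ℤ) (eb : B ≃* Multiplicative ℤ) (f : A →* B)
    (hf : Function.Injective f) : ∃ N : ℕ, N ≠ 0 ∧ ∀ b, b ^ N ∈ f.range := by
  let a := ea.symm (Multiplicative.ofAdd 1)
  let m := (eb (f a)).toAdd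
  have hm : m ≠ 0 := by
    intro h
    have h₁ : f a = 1 := by
      apply eb.injective; rw [map_one]; exact h
    rw [map_eq_one_iff f hf] at h₁
    have h₂ := congrArg (fun x => (ea x).toAdd) h₁
    simp [a] at h₂
  refine ⟨m.natAbs, by simpa using hm, fun b => ?_⟩
  have h₁ : b ^ m ∈ f.range := by
    refine ⟨a ^ (eb b).toAdd, ?_⟩
    apply eb.injective
    rw [map_zpow, map_zpow, map_zpow]
    change (eb b).toAdd • m = m • (eb b).toAdd
    simp [mul_comm]
  rcases Int.natAbs_eq m with h | h
  · rwa [h, zpow_natCast] at h₁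
  · rwa [h, zpow_neg, inv_mem_iff, zpow_natCast] at h₁

/-- A homomorphism that inverts an injective homomorphism `f` up to taking `N`-th powers. -/
theorem exists_hom_apply_eq_pow {A B : Type*} [Group A] [Group B] {e : B →* B} {N : ℕ}
    (he : ∀ b, e b = b ^ N) (f : A →* B) (hf : Function.Injective f)
    (hN : ∀ b, b ^ N ∈ f.range) : ∃ ψ : B →* A, ∀ b, f (ψ b) = b ^ N :=
  ⟨(MonoidHom.ofInjective hf).symm.toMonoidHom.comp (e.codRestrict f.range fun b => by
    rw [he]; exact hN b), fun b => by
      rw [← he]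
      simp⟩

/-- Between tubular graphs of groups rigid morphisms can be reversed: multiplication by a suitable
integer `N` maps the vertex groups of the target into those of the domain. -/
theorem exists_isRigid_symm {𝒢 ℋ : GraphOfGroups.{u}} (h𝒢 : 𝒢.IsTubular) (hℋ : ℋ.IsTubular)
    (f : Morphism 𝒢 ℋ) (hf : f.IsRigid) : ∃ f' : Morphism ℋ 𝒢, f'.IsRigid := by
  have := h𝒢.finite_V
  have := h𝒢.finite_E
  have := Fintype.ofFinite 𝒢.V
  have := Fintype.ofFinite 𝒢.E
  choose NV hNV₀ hNV using fun v => exists_pow_mem_range_of_injective (h𝒢.vGrp_equiv v).some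
    (hℋ.vGrp_equiv (f.onV v)).some (f.homV v) (hf.homV_injective v)
  choose NE hNE₀ hNE using fun e => exists_pow_mem_range_of_injective_int (h𝒢.eGrp_equiv e).some
    (hℋ.eGrp_equiv (f.onE e)).some (f.homE e) (hf.homE_injective e)
  let N := (∏ v, NV v) * ∏ e, NE e
  have hN₀ : N ≠ 0 := mul_ne_zero (Finset.prod_ne_zero_iff.2 fun v _ => hNV₀ v)
    (Finset.prod_ne_zero_iff.2 fun e _ => hNE₀ e)
  have hV : ∀ v (b : ℋ.vGrp (f.onV v)), b ^ N ∈ (f.homV v).range := by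
    intro v b
    obtain ⟨c, hc⟩ := (Finset.dvd_prod_of_mem NV (Finset.mem_univ v)).mul_right (∏ e, NE e)
    simp only [N]
    rw [hc, pow_mul]
    exact pow_mem (hNV v b) c
  have hE : ∀ e (b : ℋ.eGrp (f.onE e)), b ^ N ∈ (f.homE e).range := by
    intro e b
    obtain ⟨c, hc⟩ := (Finset.dvd_prod_of_mem NE (Finset.mem_univ e)).mul_left (∏ v, NV v)
    simp only [N]
    rw [hc, pow_mul]
    exact pow_mem (hNE e b) c
  obtain ⟨C⟩ := hℋ.nonempty_coordinates
  have hψV : ∀ w, ∃ (v : 𝒢.V) (ψ : ℋ.vGrp w →* 𝒢.vGrp v), f.onV v = w ∧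
      ∀ b, (⟨f.onV v, f.homV v (ψ b)⟩ : Σ w, ℋ.vGrp w) = ⟨w, b ^ N⟩ := by
    intro w
    obtain ⟨v, rfl⟩ := hf.onV_bijective.2 w
    let e : ℋ.vGrp (f.onV v) →* ℋ.vGrp (f.onV v) :=
      ((C.cV _).symm.toMonoidHom.comp (powMonoidHom N)).comp (C.cV _).toMonoidHom
    obtain ⟨ψ, hψ⟩ := exists_hom_apply_eq_pow (e := e) (N := N) (fun b => by simp [e])
      (f.homV v) (hf.homV_injective v) (hV v)
    exact ⟨v, ψ, rfl, fun b => by rw [hψ]⟩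
  have hψE : ∀ d, ∃ (c : 𝒢.E) (ψ : ℋ.eGrp d →* 𝒢.eGrp c), f.onE c = d ∧
      ∀ b, (⟨f.onE c, f.homE c (ψ b)⟩ : Σ d, ℋ.eGrp d) = ⟨d, b ^ N⟩ := by
    intro d
    obtain ⟨c, rfl⟩ := hf.onE_bijective.2 d
    let e : ℋ.eGrp (f.onE c) →* ℋ.eGrp (f.onE c) :=
      ((C.cE _).symm.toMonoidHom.comp (powMonoidHom N)).comp (C.cE _).toMonoidHom
    obtain ⟨ψ, hψ⟩ := exists_hom_apply_eq_pow (e := e) (N := N) (fun b => by simp [e])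
      (f.homE c) (hf.homE_injective c) (hE c)
    exact ⟨c, ψ, rfl, fun b => by rw [hψ]⟩
  choose onV ψV honV hψV using hψV
  choose onE ψE honE hψE using hψE
  have hsigma : Function.Injective (fun x : Σ v, 𝒢.vGrp v =>
      (⟨f.onV x.1, f.homV x.1 x.2⟩ : Σ w, ℋ.vGrp w)) := by
    rintro ⟨v, a⟩ ⟨v', a'⟩ h
    obtain rfl := hf.onV_bijective.1 (congrArg Sigma.fst h)
    simp only [Sigma.mk.injEq, heq_eq_eq, true_and] at h
    rw [hf.homV_injective v h]
  have hatt : ∀ {c d : ℋ.E} {x : ℋ.eGrp c} {y : ℋ.eGrp d} (s : Bool),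
      (⟨c, x⟩ : Σ d, ℋ.eGrp d) = ⟨d, y⟩ →
      (⟨ℋ.vert c s, ℋ.att c s x⟩ : Σ w, ℋ.vGrp w) = ⟨ℋ.vert d s, ℋ.att d s y⟩ := by
    intro c d x y s h
    cases h
    rfl
  have hone : ∀ {ι : Type u} {G : ι → Type u} [∀ i, Group (G i)] {i j : ι} {g : G j},
      (⟨i, 1⟩ : Σ i, G i) = ⟨j, g⟩ → g = 1 := by
    intro ι G _ i j g h
    cases h
    rfl
  refine exists_isRigid onV onE (fun d => f.rev (onE d)) ψV ψE (fun d s g => hsigma ?_)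
    ⟨fun w w' h => by rw [← honV w, h, honV], fun v => ⟨f.onV v, hf.onV_bijective.1 (honV _)⟩⟩
    ⟨fun w w' h => by rw [← honE w, h, honE], fun v => ⟨f.onE v, hf.onE_bijective.1 (honE _)⟩⟩
    (fun w => (injective_iff_map_eq_one _).2 fun b hb => ?_)
    (fun d => (injective_iff_map_eq_one _).2 fun b hb => ?_)
  · simp only
    rw [hψV, f.comm, ← map_pow]
    have := hatt s (hψE d g)
    rw [← this, ← Bool.xor_assoc, Bool.xor_self, Bool.false_xor]
  · have h := hψV w b
    rw [hb, map_one] at h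
    have h₁ := congrArg (fun g => (C.cV w g).toAdd) (hone h)
    simpa [hN₀, -nsmul_eq_mul] using h₁
  · have h := hψE d b
    rw [hb, map_one] at h
    have h₁ := congrArg (fun g => (C.cE d g).toAdd) (hone h)
    simpa [hN₀] using h₁

end GraphOfGroups

theorem IsPrimitiveElement.mono {A : Type*} [Group A] {K K' : Subgroup A} {x : A}
    (h : IsPrimitiveElement K' x) (hK : K ≤ K') (hx : x ∈ K) : IsPrimitiveElement K x :=
  ⟨hx, h.2.1, fun y hy n hn => h.2.2 y (hK hy) n hn⟩

theorem IsPrimitiveElement.inv {A : Type*} [Group A] {K : Subgroup A} {x : A}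
    (h : IsPrimitiveElement K x) : IsPrimitiveElement K x⁻¹ :=
  ⟨inv_mem h.1, inv_ne_one.2 h.2.1, fun y hy n hn => by
    have := h.2.2 y hy (-n) (by rw [zpow_neg, hn, inv_inv])
    omega⟩

namespace GraphOfGroups

/-! ### Regulating tuples -/

namespace Coordinates

variable {𝒢 : GraphOfGroups.{u}} (C : 𝒢.Coordinates)

theorem eq_gen_or_eq_inv {e : 𝒢.E} {g : 𝒢.eGrp e} (hg : Subgroup.zpowers g = ⊤) :
    g = C.gen e ∨ g = (C.gen e)⁻¹ := by
  obtain ⟨n, hn⟩ : C.gen e ∈ Subgroup.zpowers g := hg ▸ Subgroup.mem_top _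
  have h₁ := congrArg (fun g => (C.cE e g).toAdd) hn
  simp only [map_zpow, gen, MulEquiv.apply_symm_apply, toAdd_zpow, toAdd_ofAdd, smul_eq_mul] at h₁
  rcases Int.eq_one_or_neg_one_of_mul_eq_one ((mul_comm _ _).trans h₁) with h | h
  · exact .inl (by rw [C.eq_gen_zpow e g, h, zpow_one])
  · exact .inr (by rw [C.eq_gen_zpow e g, h, zpow_neg_one])

theorem zpowers_gen (e : 𝒢.E) : Subgroup.zpowers (C.gen e) = ⊤ :=
  eq_top_iff.2 fun g _ => ⟨_, (C.eq_gen_zpow e g).symm⟩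

/-- The powers `k_e` of the generators of the edge groups lie in the subgroups `H v` of the vertex
groups and are primitive there. -/
def Regulates (H : ∀ v, Subgroup (𝒢.vGrp v)) (k : 𝒢.E → ℤ) : Prop :=
  ∀ e s, IsPrimitiveElement (H (𝒢.vert e s)) (𝒢.att e s (C.gen e ^ k e))

variable {C}

theorem scaledSubgroup_le {H : ∀ v, Subgroup (𝒢.vGrp v)} {k : 𝒢.E → ℤ}
    (h : ∀ e s, 𝒢.att e s (C.gen e ^ k e) ∈ H (𝒢.vert e s)) (v : 𝒢.V) :
    𝒢.scaledSubgroup k v ≤ H v := by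
  refine (Subgroup.closure_le _).2 ?_
  rintro _ ⟨e, s, g⟩
  rw [C.eq_gen_zpow e g, ← zpow_mul, mul_comm, zpow_mul, map_zpow]
  exact zpow_mem (h e s) _

theorem isRegulating_iff {k : 𝒢.E → ℤ} :
    𝒢.IsRegulating k ↔ C.Regulates (𝒢.scaledSubgroup k) k := by
  constructor
  · intro h e s
    exact h e _ (C.zpowers_gen e) s
  · intro h e g hg s
    rcases C.eq_gen_or_eq_inv hg with rfl | rfl
    · exact h e s
    · rw [inv_zpow, map_inv]
      exact (h e s).inv

theorem Regulates.isRegulating {H : ∀ v, Subgroup (𝒢.vGrp v)} {k : 𝒢.E → ℤ}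
    (h : C.Regulates H k) : 𝒢.IsRegulating k :=
  isRegulating_iff.2 fun e s => (h e s).mono (scaledSubgroup_le (fun e s => (h e s).1) _)
    (Subgroup.subset_closure ⟨e, s, C.gen e⟩)

theorem Regulates.ne_zero {H : ∀ v, Subgroup (𝒢.vGrp v)} {k : 𝒢.E → ℤ}
    (h : C.Regulates H k) (e : 𝒢.E) : k e ≠ 0 := by
  intro h0
  apply (h e true).2.1
  rw [h0, zpow_zero, map_one]

theorem Regulates.att_gen_zpow_mem {H : ∀ v, Subgroup (𝒢.vGrp v)} {k : 𝒢.E → ℤ}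
    (h : C.Regulates H k) (e : 𝒢.E) (s : Bool) (n : ℤ) :
    𝒢.att e s (C.gen e ^ n) ∈ H (𝒢.vert e s) ↔ k e ∣ n := by
  constructor
  · intro hn
    -- the power given by `gcd n k` also lies in `H`
    have h₁ : 𝒢.att e s (C.gen e ^ (Int.gcd n (k e) : ℤ)) ∈ H (𝒢.vert e s) := by
      rw [Int.gcd_eq_gcd_ab, zpow_add, zpow_mul, zpow_mul, map_mul, map_zpow _ _ (Int.gcdA _ _),
        map_zpow _ _ (Int.gcdB _ _)]
      exact mul_mem (zpow_mem hn _) (zpow_mem (h e s).1 _)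
    obtain ⟨c, hc⟩ := Int.gcd_dvd_right n (k e)
    have h₂ := (h e s).2.2 _ h₁ c (by rw [← map_zpow, ← zpow_mul, ← hc])
    refine dvd_trans ?_ (Int.gcd_dvd_left n (k e))
    rcases h₂ with rfl | rfl
    · rw [mul_one] at hc; rw [← hc]
    · rw [hc]; simp
  · rintro ⟨c, rfl⟩
    rw [zpow_mul, map_zpow]
    exact zpow_mem (h e s).1 c

/-- Every subgroup of `ℤ²` is contained, as a pure subgroup, in a subgroup of finite index. -/
theorem _root_.GraphOfGroups.exists_finiteIndex_pure (S : AddSubgroup (ℤ × ℤ)) :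
    ∃ L : AddSubgroup (ℤ × ℤ), S ≤ L ∧ L.FiniteIndex ∧
      ∀ z ∈ L, ∀ n : ℤ, n ≠ 0 → n • z ∈ S → z ∈ S := by
  by_cases h : ∃ a ∈ S, ∃ b ∈ S, det a b ≠ 0
  · obtain ⟨a, ha, b, hb, hab⟩ := h
    refine ⟨S, le_rfl, finiteIndex_of_smul_mem hab fun z => ?_, fun z hz _ _ _ => hz⟩
    rw [det_smul_eq]
    exact add_mem (zsmul_mem ha _) (zsmul_mem hb _)
  push Not at h
  by_cases h₀ : ∃ a ∈ S, a ≠ 0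
  · -- a vector orthogonal to the line that contains `S` spans a complement
    obtain ⟨a, ha, ha₀⟩ := h₀
    refine ⟨S ⊔ AddSubgroup.zmultiples (-a.2, a.1), le_sup_left,
      finiteIndex_of_smul_mem (exists_det_ne_zero ha₀) fun z => ?_, fun z hz n hn hnz => ?_⟩
    · rw [det_smul_eq]
      exact add_mem (zsmul_mem (AddSubgroup.mem_sup_left ha) _)
        (zsmul_mem (AddSubgroup.mem_sup_right (AddSubgroup.mem_zmultiples _)) _)
    · obtain ⟨y, hy, w, ⟨m, rfl⟩, rfl⟩ := AddSubgroup.mem_sup.1 hz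
      have h₁ := h a ha _ hnz
      have h₂ := h a ha _ hy
      have h₃ : n * m * det a (-a.2, a.1) = 0 := by
        simp only [det, Prod.fst_add, Prod.snd_add, Prod.smul_fst, Prod.smul_snd,
          smul_eq_mul] at h₁ h₂ ⊢
        linear_combination h₁ - n * h₂
      have h₄ : m = 0 := by simpa [hn, exists_det_ne_zero ha₀] using h₃
      simpa [h₄] using hy
  · push Not at h₀
    refine ⟨⊤, le_top, inferInstance, fun z _ n hn hz => ?_⟩
    rw [(smul_eq_zero.1 (h₀ _ hz)).resolve_left hn]
    exact zero_mem _

variable (C) in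
theorem exists_regulates_finiteIndex {k : 𝒢.E → ℤ} (h : 𝒢.IsRegulating k) :
    ∃ H : ∀ v, Subgroup (𝒢.vGrp v), (∀ v, (H v).FiniteIndex) ∧ C.Regulates H k := by
  have h := (isRegulating_iff (C := C)).1 h
  have key : ∀ v, ∃ K : Subgroup (𝒢.vGrp v), K.FiniteIndex ∧ 𝒢.scaledSubgroup k v ≤ K ∧
      ∀ y ∈ K, ∀ n : ℤ, n ≠ 0 → y ^ n ∈ 𝒢.scaledSubgroup k v → y ∈ 𝒢.scaledSubgroup k v := by
    intro v
    obtain ⟨L, hSL, hL, hpure⟩ := exists_finiteIndex_pure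
      (Subgroup.toAddSubgroup' ((𝒢.scaledSubgroup k v).comap (C.cV v).symm.toMonoidHom))
    refine ⟨(AddSubgroup.toSubgroup L).comap (C.cV v).toMonoidHom, ?_, ?_, ?_⟩
    · have : (AddSubgroup.toSubgroup L).FiniteIndex :=
        (AddSubgroup.finiteIndex_toSubgroup_iff L).2 hL
      exact finiteIndex_comap _ _
    · intro y hy
      refine hSL (x := (C.cV v y).toAdd) ?_
      change (C.cV v).symm (C.cV v y) ∈ 𝒢.scaledSubgroup k v
      simpa using hy
    · intro y hy n hn hyn
      have := hpure (C.cV v y).toAdd hy n hn (by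
        change (C.cV v).symm ((C.cV v y) ^ n) ∈ 𝒢.scaledSubgroup k v
        simpa using hyn)
      change (C.cV v).symm (C.cV v y) ∈ 𝒢.scaledSubgroup k v at this
      simpa using this
  choose H hH₁ hH₂ hH₃ using key
  refine ⟨H, hH₁, fun e s => ⟨hH₂ _ (h e s).1, (h e s).2.1, fun y hy n hn => ?_⟩⟩
  refine (h e s).2.2 y (hH₃ _ y hy n ?_ (hn ▸ (h e s).1)) n hn
  rintro rfl
  exact (h e s).2.1 (by rw [← hn, zpow_zero])

end Coordinates

theorem exists_isRegulating_of_hasPrimitiveDomain {𝒢 : GraphOfGroups.{u}} (h𝒢 : 𝒢.IsTubular)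
    (h : 𝒢.HasPrimitiveDomain) : ∃ k, 𝒢.IsRegulating k := by
  obtain ⟨ℋ, hℋ, hprim, f, hf⟩ := h
  obtain ⟨C⟩ := h𝒢.nonempty_coordinates
  obtain ⟨D⟩ := hℋ.nonempty_coordinates
  have h₁ : ∀ v, ∃ K : Subgroup (𝒢.vGrp v), ∀ u, f.onV u = v →
      ∀ x, x ∈ K ↔ ∃ y, (⟨f.onV u, f.homV u y⟩ : Σ v, 𝒢.vGrp v) = ⟨v, x⟩ := by
    intro v
    obtain ⟨u, rfl⟩ := hf.onV_bijective.2 v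
    refine ⟨(f.homV u).range, fun u' hu' x => ?_⟩
    obtain rfl := hf.onV_bijective.1 hu'
    simp
  have h₂ : ∀ e, ∃ (d : ℋ.E) (k : ℤ), f.onE d = e ∧
      (⟨f.onE d, f.homE d (D.gen d)⟩ : Σ e, 𝒢.eGrp e) = ⟨e, C.gen e ^ k⟩ := by
    intro e
    obtain ⟨d, rfl⟩ := hf.onE_bijective.2 e
    exact ⟨d, _, rfl, by rw [← C.eq_gen_zpow]⟩
  choose H hH using h₁
  choose d k hd hk using h₂
  refine ⟨k, Coordinates.Regulates.isRegulating (C := C) (H := H) fun e s => ?_⟩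
  have hatt : ∀ {c e : 𝒢.E} {x : 𝒢.eGrp c} {y : 𝒢.eGrp e} (s : Bool),
      (⟨c, x⟩ : Σ e, 𝒢.eGrp e) = ⟨e, y⟩ →
      (⟨𝒢.vert c s, 𝒢.att c s x⟩ : Σ v, 𝒢.vGrp v) = ⟨𝒢.vert e s, 𝒢.att e s y⟩ := by
    intro c e x y s h
    cases h
    rfl
  have h₃ := f.comm (d e) (xor (f.rev (d e)) s) (D.gen (d e))
  rw [← Bool.xor_assoc, Bool.xor_self, Bool.false_xor, hatt s (hk e)] at h₃
  have h₄ := hH (𝒢.vert e s)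
  have h₅ := D.isPrimitive_iff.1 hprim (d e) (xor (f.rev (d e)) s)
  have h₆ : ℋ.att (d e) (xor (f.rev (d e)) s) (D.gen (d e)) ≠ 1 := fun h =>
    one_ne_zero (D.att_gen_zpow_eq_one (n := 1) (by rw [zpow_one, h]))
  generalize 𝒢.att e s (C.gen e ^ k e) = x at *
  generalize H (𝒢.vert e s) = K at *
  generalize ℋ.att (d e) (xor (f.rev (d e)) s) (D.gen (d e)) = y at *
  generalize ℋ.vert (d e) (xor (f.rev (d e)) s) = u at *
  generalize 𝒢.vert e s = v at *
  cases h₃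
  have h₇ := h₄ u rfl
  simp only [Sigma.mk.injEq, heq_eq_eq, true_and] at h₇
  refine ⟨(h₇ _).2 ⟨y, rfl⟩, ?_, fun z hz n hn => ?_⟩
  · rwa [Ne, map_eq_one_iff _ (hf.homV_injective u)]
  · obtain ⟨w, rfl⟩ := (h₇ _).1 hz
    rw [← map_zpow] at hn
    exact h₅ w n (hf.homV_injective u hn)

/-! ### Separable edge groups -/

theorem exists_primitiveVec {a : ℤ × ℤ} (ha : a ≠ 0) :
    ∃ (y : ℤ × ℤ) (m : ℤ), PrimitiveVec y ∧ m ≠ 0 ∧ a = m • y := by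
  have hg : (Int.gcd a.1 a.2 : ℤ) ≠ 0 := by
    intro h
    rw [Int.natCast_eq_zero, Int.gcd_eq_zero_iff] at h
    exact ha (Prod.ext h.1 h.2)
  have key : a = (Int.gcd a.1 a.2 : ℤ) • (a.1 / (Int.gcd a.1 a.2 : ℤ), a.2 / (Int.gcd a.1 a.2 : ℤ))
    := by
    ext
    · simp [Int.mul_ediv_cancel' (Int.gcd_dvd_left _ _)]
    · simp [Int.mul_ediv_cancel' (Int.gcd_dvd_right _ _)]
  refine ⟨_, _, fun y n hn => ?_, hg, key⟩
  rw [← hn, smul_smul] at key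
  have h₁ : (Int.gcd a.1 a.2 : ℤ) * n ∣ Int.gcd a.1 a.2 :=
    Int.dvd_coe_gcd ⟨y.1, congrArg Prod.fst key⟩ ⟨y.2, congrArg Prod.snd key⟩
  obtain ⟨c, hc⟩ := h₁
  rw [mul_assoc] at hc
  exact Int.eq_one_or_neg_one_of_mul_eq_one (mul_left_cancel₀ hg ((mul_one _).trans hc).symm)

namespace Coordinates

variable {𝒢 : GraphOfGroups.{u}} (C : 𝒢.Coordinates)

/-- If the edge group at the end of the path `q` is separable, there is a subgroup of finite index
whose intersection with the maximal cyclic subgroup that contains the edge group lies in the edge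
group. -/
theorem exists_finiteIndex_dvd [Finite 𝒢.V] {v w : 𝒢.V} {q : 𝒢.PathGroup} (hq : 𝒢.IsPath v w q)
    {y : ℤ × ℤ} (hy : y ≠ 0) {m : ℤ} (hm : m ≠ 0) {S : Subgroup (𝒢.piOne v)}
    (hS : IsSeparableSubgroup S)
    (hmem : ∀ x : 𝒢.piOne v, x ∈ S ↔ ∃ n : ℤ, (x : 𝒢.PathGroup) = q * C.el w (n • m • y) * q⁻¹) :
    ∃ K : Subgroup (𝒢.piOne v), K.FiniteIndex ∧
      ∀ (j : ℤ) (x : 𝒢.piOne v), x ∈ K → (x : 𝒢.PathGroup) = q * C.el w (j • y) * q⁻¹ → m ∣ j := by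
  obtain ⟨𝒮, h𝒮, rfl⟩ := hS
  let X : ℤ → 𝒢.piOne v := fun j =>
    ⟨q * C.el w (j • y) * q⁻¹, (hq.mul (C.isPath_el w _)).mul hq.inv⟩
  have hX : ∀ i j, X (i + j) = X i * X j := by
    intro i j
    apply Subtype.ext
    simp only [X, add_smul, el_add, Subgroup.coe_mul]
    group
  have hXm : ∀ i, X (i * m) ∈ sInf 𝒮 := fun i => (hmem _).2 ⟨i, by simp only [X, mul_smul]⟩
  have h₁ : ∀ r : Fin m.natAbs, ∃ K ∈ insert ⊤ 𝒮, (r : ℕ) ≠ 0 → X (r : ℕ) ∉ K := by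
    intro r
    by_cases hr : (r : ℕ) = 0
    · exact ⟨⊤, Set.mem_insert _ _, fun h => absurd hr h⟩
    have : X (r : ℕ) ∉ sInf 𝒮 := by
      rw [hmem]
      rintro ⟨n, hn⟩
      have h₂ := C.el_injective w (mul_left_cancel (mul_right_cancel hn))
      rw [← sub_eq_zero, smul_smul, ← sub_smul, smul_eq_zero, or_iff_left hy, sub_eq_zero] at h₂
      have h₃ : m.natAbs ∣ (r : ℕ) := Int.natCast_dvd_natCast.1
        (Int.natAbs_dvd.2 ⟨n, by rw [h₂, mul_comm]⟩)
      exact absurd (Nat.le_of_dvd (Nat.pos_of_ne_zero hr) h₃) (not_le.2 r.2)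
    rw [Subgroup.mem_sInf] at this
    push Not at this
    obtain ⟨K, hK, hK'⟩ := this
    exact ⟨K, Set.mem_insert_of_mem _ hK, fun _ => hK'⟩
  choose K hK hK' using h₁
  refine ⟨⨅ r, K r, Subgroup.finiteIndex_iInf fun r => ?_, fun j x hx hj => ?_⟩
  · rcases hK r with h | h
    · rw [h]; infer_instance
    · exact h𝒮 _ h
  · obtain rfl : x = X j := Subtype.ext hj
    by_contra hjm
    have hr0 : 0 ≤ j % m := Int.emod_nonneg _ hm
    have hr1 : j % m < m.natAbs := by
      rw [Int.natCast_natAbs]; exact Int.emod_lt_abs j hm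
    let r : Fin m.natAbs := ⟨(j % m).toNat, by omega⟩
    have hr : ((r : ℕ) : ℤ) = j % m := Int.toNat_of_nonneg hr0
    refine hK' r (fun h => hjm ?_) ?_
    · refine Int.dvd_of_emod_eq_zero ?_
      rw [← hr, h]; rfl
    · have h₂ : X j ∈ K r := (Subgroup.mem_iInf.1 hx) r
      have h₃ : X ((j / m) * m) ∈ K r := by
        rcases hK r with h | h
        · rw [h]; trivial
        · exact Subgroup.mem_sInf.1 (hXm _) _ h
      have h₄ : X j = X (r : ℕ) * X ((j / m) * m) := by
        rw [← hX, hr]; congr 1; rw [mul_comm, Int.emod_add_mul_ediv]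
      rw [h₄] at h₂
      exact (Subgroup.mul_mem_cancel_right _ h₃).1 h₂

end Coordinates

theorem IsTubular.exists_isRegulating_of_isSeparable {𝒢 : GraphOfGroups.{u}} (h𝒢 : 𝒢.IsTubular)
    {v₀ : 𝒢.V} (hsep : ∀ (e : 𝒢.E) (p : 𝒢.PathGroup), 𝒢.IsPath v₀ (𝒢.vert e false) p →
        IsSeparableSubgroup (𝒢.edgeSubgroup v₀ e p)) : ∃ k, 𝒢.IsRegulating k := by
  obtain ⟨C⟩ := h𝒢.nonempty_coordinates
  have := h𝒢.finite_V
  have := h𝒢.finite_E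
  choose r hr using h𝒢.connected.exists_isPath v₀
  let p : 𝒢.E → 𝒢.PathGroup := fun e => r (𝒢.vert e false)
  have hp : ∀ e, 𝒢.IsPath v₀ (𝒢.vert e false) (p e) := fun e => hr _
  let q : 𝒢.E → Bool → 𝒢.PathGroup := fun e s => if s then p e * 𝒢.letter e else p e
  have hq : ∀ e s, 𝒢.IsPath v₀ (𝒢.vert e s) (q e s) := by
    rintro e (_ | _)
    · exact hp e
    · exact (hp e).mul (.letter e)
  have hqp : ∀ e s (n : ℤ), q e s * C.el (𝒢.vert e s) (n • C.vec e s) * (q e s)⁻¹ =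
      p e * C.el (𝒢.vert e false) (n • C.vec e false) * (p e)⁻¹ := by
    rintro e (_ | _) n
    · rfl
    · have h₁ := C.dirLetter_mul_el e true n
      simp only [dirLetter, if_true, Bool.not_true] at h₁
      simp only [q, if_true]
      rw [mul_assoc (p e), h₁]
      group
  choose y m hy hm hvec using fun e s => exists_primitiveVec (C.vec_ne_zero e s)
  have hy₀ : ∀ e s, y e s ≠ 0 := fun e s h => C.vec_ne_zero e s (by rw [hvec, h, smul_zero])
  choose K hK hK' using fun e s => C.exists_finiteIndex_dvd (hq e s) (hy₀ e s) (hm e s)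
    (hsep e (p e) (hp e)) (fun x => by simp only [C.mem_edgeSubgroup, ← hvec, hqp])
  let N : Subgroup (𝒢.piOne v₀) := ⨅ x : 𝒢.E × Bool, (K x.1 x.2).normalCore
  have hN : N.FiniteIndex := Subgroup.finiteIndex_iInf fun x => inferInstance
  have hNn : N.Normal := Subgroup.normal_iInf_normal fun x => inferInstance
  have hNK : ∀ e s, N ≤ K e s := fun e s =>
    (iInf_le _ (e, s)).trans (Subgroup.normalCore_le _)
  let M : Subgroup 𝒢.PathGroup := N.map (𝒢.piOne v₀).subtype
  have hM : ∀ {w} {a b : 𝒢.PathGroup} (x : 𝒢.PathGroup), 𝒢.IsPath v₀ w a → 𝒢.IsPath v₀ w b →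
      a * x * a⁻¹ ∈ M → b * x * b⁻¹ ∈ M := by
    rintro w a b x ha hb ⟨n, hn, hn'⟩
    refine ⟨⟨b * a⁻¹, hb.mul ha.inv⟩ * n * ⟨b * a⁻¹, hb.mul ha.inv⟩⁻¹, hNn.conj_mem n hn _, ?_⟩
    simp only [Subgroup.subtype_apply] at hn'
    simp [hn', mul_assoc]
  let H : ∀ v, Subgroup (𝒢.vGrp v) := fun v =>
    M.comap ((MulAut.conj (r v)).toMonoidHom.comp (𝒢.ofV v))
  have hH : ∀ {v} {a : 𝒢.PathGroup} (g : 𝒢.vGrp v), 𝒢.IsPath v₀ v a →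
      (g ∈ H v ↔ a * 𝒢.ofV v g * a⁻¹ ∈ M) := by
    intro v a g ha
    exact ⟨hM _ (hr v) ha, hM _ ha (hr v)⟩
  have hatt : ∀ e s (n : ℤ), 𝒢.att e s (C.gen e ^ n) ∈ H (𝒢.vert e s) ↔
      p e * C.el (𝒢.vert e false) (n • C.vec e false) * (p e)⁻¹ ∈ M := by
    intro e s n
    rw [hH _ (hq e s), ← hqp e s, C.ofV_att]
    simp [Coordinates.gen, -zsmul_eq_mul]
  have hk : ∀ e, ∃ k : ℤ, k ≠ 0 ∧ ∀ s (n : ℤ),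
      𝒢.att e s (C.gen e ^ n) ∈ H (𝒢.vert e s) ↔ k ∣ n := by
    intro e
    let A : AddSubgroup ℤ := Subgroup.toAddSubgroup' (M.comap
      (zpowersHom _ (p e * C.el (𝒢.vert e false) (C.vec e false) * (p e)⁻¹)))
    have hA : ∀ n : ℤ, n ∈ A ↔ p e * C.el (𝒢.vert e false) (n • C.vec e false) * (p e)⁻¹ ∈ M := by
      intro n
      rw [Coordinates.el_zsmul, ← conj_zpow]
      rfl
    obtain ⟨k, hk⟩ := Int.subgroup_cyclic A
    rw [← AddSubgroup.zmultiples_eq_closure] at hk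
    refine ⟨k, ?_, fun s n => ?_⟩
    · rintro rfl
      obtain ⟨n, hn, -, hn'⟩ := Subgroup.exists_pow_mem_of_index_ne_zero hN.index_ne_zero
        (⟨p e * C.el (𝒢.vert e false) (C.vec e false) * (p e)⁻¹,
          ((hp e).mul (C.isPath_el _ _)).mul (hp e).inv⟩ : 𝒢.piOne v₀)
      have h₁ : (n : ℤ) ∈ A := by
        rw [hA, Coordinates.el_zsmul, ← conj_zpow, zpow_natCast]
        exact ⟨_, hn', rfl⟩
      rw [hk, Int.mem_zmultiples_iff, zero_dvd_iff] at h₁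
      omega
    · rw [hatt, ← hA, hk, Int.mem_zmultiples_iff]
  choose k hk₀ hk using hk
  refine ⟨k, Coordinates.Regulates.isRegulating (C := C) (H := H) fun e s =>
    ⟨(hk e s _).2 dvd_rfl, fun h => ?_, fun x hx n hn => ?_⟩⟩
  · rw [map_zpow] at h
    exact hk₀ e (C.att_gen_zpow_eq_one h)
  · have h₁ : n • (C.cV _ x).toAdd = k e • C.vec e s := by
      have := congrArg (fun x => (C.cV _ x).toAdd) hn
      simpa [C.cV_att, Coordinates.gen, -zsmul_eq_mul] using this
    have hkv : k e • C.vec e s ≠ 0 := smul_ne_zero (hk₀ e) (C.vec_ne_zero e s)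
    have hn₀ : n ≠ 0 := by
      rintro rfl
      rw [zero_smul] at h₁
      exact hkv h₁.symm
    obtain ⟨j, hj⟩ := (hy e s).exists_smul_eq (b := (C.cV _ x).toAdd) (by
      have h₂ : n * det (y e s) (C.cV _ x).toAdd = 0 := by
        have h₃ : det (y e s) (n • (C.cV _ x).toAdd) = 0 := by
          rw [h₁, hvec, smul_smul, det_smul_self]
        simp only [det, Prod.smul_fst, Prod.smul_snd, smul_eq_mul] at h₃ ⊢
        linear_combination h₃
      exact (mul_eq_zero.1 h₂).resolve_left hn₀)
    obtain ⟨x', hx', hxx⟩ := (hH x (hq e s)).1 hx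
    obtain ⟨i, rfl⟩ := hK' e s j x' (hNK e s hx') (by
      rw [← hj, ← C.ofV_eq_el]; exact hxx)
    have hx₁ : x = 𝒢.att e s (C.gen e ^ i) := by
      apply (C.cV _).injective
      apply Multiplicative.toAdd.injective
      rw [hj, C.cV_att, hvec, smul_smul, mul_comm]
      simp [Coordinates.gen]
    rw [hx₁, hk] at hx
    obtain ⟨c, rfl⟩ := hx
    rw [hx₁, ← map_zpow, ← zpow_mul] at hn
    have h₂ : C.gen e ^ (k e * c * n - k e) = 1 := by
      rw [zpow_sub, 𝒢.att_injective e s hn, mul_inv_cancel]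
    have h₃ := C.gen_zpow_eq_one h₂
    have h₄ : k e * (n * c) = k e * 1 := by linarith
    exact Int.eq_one_or_neg_one_of_mul_eq_one (mul_left_cancel₀ (hk₀ e) h₄)

/-! ### Graphs of point stabilizers -/

theorem nonempty_mulEquiv_of_range_eq {A B : Type*} [Group A] [Group B] {f : B →* A}
    (hf : Function.Injective f) {K : Subgroup A} (hK : f.range = K) : Nonempty (K ≃* B) := by
  subst hK
  exact ⟨(MonoidHom.ofInjective hf).symm⟩

theorem nonempty_mulEquiv_of_finiteIndex {A : Type*} [Group A]
    (e : A ≃* Multiplicative (ℤ × ℤ)) (K : Subgroup A) [hK : K.FiniteIndex] :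
    Nonempty (K ≃* Multiplicative (ℤ × ℤ)) := by
  let L : Submodule ℤ (ℤ × ℤ) :=
    AddSubgroup.toIntSubmodule (Subgroup.toAddSubgroup' (K.comap e.symm.toMonoidHom))
  have hL : ∀ z, z ∈ L ↔ e.symm (Multiplicative.ofAdd z) ∈ K := fun z => Iff.rfl
  have hidx : ∀ z : ℤ × ℤ, K.index.factorial • z ∈ L := by
    intro z
    rw [hL, ofAdd_nsmul, map_pow]
    exact Subgroup.pow_mem_of_index_ne_zero_of_dvd hK.index_ne_zero _ fun m h₁ h₂ =>
      Nat.dvd_factorial h₁ h₂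
  have hle : Module.finrank ℤ L ≤ 2 := by
    simpa using Submodule.finrank_le L
  have hge : 2 ≤ Module.finrank ℤ L := by
    let f : (ℤ × ℤ) →ₗ[ℤ] L :=
      (LinearMap.lsmul ℤ (ℤ × ℤ) (K.index.factorial : ℤ)).codRestrict L fun z => by
        rw [LinearMap.lsmul_apply, natCast_zsmul]
        exact hidx z
    have hf : Function.Injective f := by
      intro y z h
      have h₁ := congrArg Subtype.val h
      exact smul_right_injective _ (Nat.cast_ne_zero.2 (Nat.factorial_ne_zero K.index)) h₁
    simpa using LinearMap.finrank_le_finrank_of_injective hf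
  let φ : (ℤ × ℤ) ≃ₗ[ℤ] L := LinearEquiv.ofFinrankEq _ _ (by simpa using le_antisymm hge hle)
  let f : Multiplicative (ℤ × ℤ) →* A :=
    e.symm.toMonoidHom.comp (L.subtype.comp φ.toLinearMap).toAddMonoidHom.toMultiplicative
  have hf : Function.Injective f := by
    intro y z h
    exact φ.injective (Subtype.ext (e.symm.injective h))
  refine nonempty_mulEquiv_of_range_eq hf ?_
  ext x
  constructor
  · rintro ⟨z, rfl⟩
    exact (φ z).2
  · intro hx
    refine ⟨φ.symm ⟨(e x).toAdd, by rw [hL]; simpa using hx⟩, ?_⟩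
    change e.symm (Multiplicative.ofAdd ((φ (φ.symm _) : L) : ℤ × ℤ)) = x
    simp

section Cover

variable {𝒢 : GraphOfGroups.{u}} (H : ∀ v, Subgroup (𝒢.vGrp v))
  (hH : ∀ e (g : 𝒢.eGrp e), 𝒢.att e true g ∈ H (𝒢.vert e true) ↔
    𝒢.att e false g ∈ H (𝒢.vert e false))
  {X : Type u} (P : 𝒢.V → X → Prop) (Q : 𝒢.E → X → Prop) (nxt : 𝒢.E → Bool → X → X)
  (hn : ∀ e s x, Q e x → P (𝒢.vert e s) (nxt e s x))

/-- A graph of groups over `𝒢`: the vertices and the edges are pairs of a vertex or an edge of `𝒢`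
and a point of `X`, subject to the conditions `P` and `Q`; the end `s` of the edge `(e, x)` has
second component `nxt e s x`. The vertex groups are the subgroups `H v`, and the edge groups are
their intersections with the edge groups of `𝒢`. -/
abbrev cover : GraphOfGroups.{u} where
  V := {p : 𝒢.V × X // P p.1 p.2}
  E := {p : 𝒢.E × X // Q p.1 p.2}
  vert e s := ⟨(𝒢.vert e.1.1 s, nxt e.1.1 s e.1.2), hn _ _ _ e.2⟩
  vGrp w := H w.1.1
  eGrp e := (H (𝒢.vert e.1.1 false)).comap (𝒢.att e.1.1 false)
  att e s := ((𝒢.att e.1.1 s).comp (Subgroup.subtype _)).codRestrict (H (𝒢.vert e.1.1 s))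
    fun g => by
      cases s
      · exact g.2
      · exact (hH _ _).2 g.2
  att_injective e s g h hgh := Subtype.ext (𝒢.att_injective _ s (congrArg Subtype.val hgh))

variable {H hH P Q nxt hn}

theorem range_cover_att {C : 𝒢.Coordinates} {k : 𝒢.E → ℤ} (hk : C.Regulates H k)
    (e : (cover H hH P Q nxt hn).E) (s : Bool) :
    ((cover H hH P Q nxt hn).att e s).range =
      Subgroup.zpowers (⟨𝒢.att e.1.1 s (C.gen e.1.1 ^ k e.1.1), (hk e.1.1 s).1⟩ :
        H (𝒢.vert e.1.1 s)) := by
  ext x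
  constructor
  · rintro ⟨g, rfl⟩
    have h₁ : 𝒢.att e.1.1 false (C.gen e.1.1 ^ (C.cE e.1.1 g.1).toAdd) ∈
        H (𝒢.vert e.1.1 false) := by rw [← C.eq_gen_zpow]; exact g.2
    obtain ⟨c, hc⟩ := (hk.att_gen_zpow_mem e.1.1 false _).1 h₁
    refine ⟨c, Subtype.ext ?_⟩
    change 𝒢.att e.1.1 s (C.gen e.1.1 ^ k e.1.1) ^ c = 𝒢.att e.1.1 s g.1
    rw [← map_zpow, ← zpow_mul, ← hc, ← C.eq_gen_zpow]
  · rintro ⟨c, rfl⟩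
    refine ⟨⟨(C.gen e.1.1 ^ k e.1.1) ^ c, ?_⟩, Subtype.ext ?_⟩
    · rw [Subgroup.mem_comap, map_zpow]
      exact zpow_mem (hk e.1.1 false).1 c
    · exact map_zpow (𝒢.att e.1.1 s) _ c

theorem isPrimitive_cover {C : 𝒢.Coordinates} {k : 𝒢.E → ℤ} (hk : C.Regulates H k) :
    (cover H hH P Q nxt hn).IsPrimitive := by
  intro e s
  rw [range_cover_att hk]
  refine (maximal_isCyclic_zpowers_iff fun n hn => ?_).2 fun y n hy => ?_
  · have h₁ := congrArg Subtype.val hn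
    change 𝒢.att e.1.1 s (C.gen e.1.1 ^ k e.1.1) ^ n = 1 at h₁
    rw [map_zpow, ← zpow_mul] at h₁
    exact (mul_eq_zero.1 (C.att_gen_zpow_eq_one h₁)).resolve_left (hk.ne_zero _)
  · exact (hk e.1.1 s).2.2 y.1 y.2 n (congrArg Subtype.val hy)

theorem isTubular_cover (h𝒢 : 𝒢.IsTubular) [Finite X] (hfin : ∀ v, (H v).FiniteIndex)
    {C : 𝒢.Coordinates} {k : 𝒢.E → ℤ} (hk : C.Regulates H k)
    (hconn : (cover H hH P Q nxt hn).Connected) : (cover H hH P Q nxt hn).IsTubular := by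
  have := h𝒢.finite_V
  have := h𝒢.finite_E
  refine ⟨inferInstanceAs (Finite {p : 𝒢.V × X // P p.1 p.2}),
    inferInstanceAs (Finite {p : 𝒢.E × X // Q p.1 p.2}), hconn, fun w => ?_, fun e => ?_⟩
  · exact nonempty_mulEquiv_of_finiteIndex (C.cV w.1.1) (H w.1.1)
  · refine nonempty_mulEquiv_of_range_eq (f := zpowersHom _ (C.gen e.1.1 ^ k e.1.1)) ?_ ?_
    · refine (injective_iff_map_eq_one _).2 fun n hn => ?_
      rw [zpowersHom_apply, ← zpow_mul] at hn
      exact (mul_eq_zero.1 (C.gen_zpow_eq_one hn)).resolve_left (hk.ne_zero _)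
    · ext g
      rw [Subgroup.mem_comap]
      conv_rhs => rw [C.eq_gen_zpow e.1.1 g, hk.att_gen_zpow_mem]
      constructor
      · rintro ⟨n, rfl⟩
        simp [Coordinates.gen]
      · rintro ⟨c, hc⟩
        refine ⟨Multiplicative.ofAdd c, ?_⟩
        rw [C.eq_gen_zpow e.1.1 g, hc, zpowersHom_apply, zpow_mul]
        rfl

end Cover

theorem Coordinates.Regulates.att_mem_iff {𝒢 : GraphOfGroups.{u}} {C : 𝒢.Coordinates}
    {H : ∀ v, Subgroup (𝒢.vGrp v)} {k : 𝒢.E → ℤ} (hk : C.Regulates H k) (e : 𝒢.E)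
    (g : 𝒢.eGrp e) : 𝒢.att e true g ∈ H (𝒢.vert e true) ↔ 𝒢.att e false g ∈ H (𝒢.vert e false) := by
  rw [C.eq_gen_zpow e g, hk.att_gen_zpow_mem, hk.att_gen_zpow_mem]

theorem IsTubular.hasPrimitiveDomain_of_isRegulating {𝒢 : GraphOfGroups.{u}} (h𝒢 : 𝒢.IsTubular)
    {k : 𝒢.E → ℤ} (hk : 𝒢.IsRegulating k) : 𝒢.HasPrimitiveDomain := by
  obtain ⟨C⟩ := h𝒢.nonempty_coordinates
  obtain ⟨H, hfin, hH⟩ := C.exists_regulates_finiteIndex hk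
  let ℋ : GraphOfGroups.{u} := cover H hH.att_mem_iff (X := PUnit) (fun _ _ => True)
    (fun _ _ => True) (fun _ _ x => x) (fun _ _ _ _ => trivial)
  have hconn : ℋ.Connected := by
    obtain ⟨⟨v⟩, hc⟩ := h𝒢.connected
    refine ⟨⟨⟨(v, ⟨⟩), trivial⟩⟩, ?_⟩
    rintro ⟨⟨v, ⟨⟩⟩, ⟨⟩⟩ ⟨⟨w, ⟨⟩⟩, ⟨⟩⟩
    induction hc v w with
    | rel a b h =>
      obtain ⟨e, rfl, rfl⟩ := h
      exact .rel _ _ ⟨⟨(e, ⟨⟩), trivial⟩, rfl, rfl⟩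
    | refl a => exact .refl _
    | symm a b _ ih => exact .symm _ _ ih
    | trans a b c _ _ ih₁ ih₂ => exact .trans _ _ _ ih₁ ih₂
  refine ⟨ℋ, isTubular_cover h𝒢 hfin hH hconn, isPrimitive_cover hH, ?_⟩
  refine exists_isRigid (𝒢 := ℋ) (ℋ := 𝒢) (fun w => w.1.1) (fun e => e.1.1) (fun _ => false)
    (fun w => (H w.1.1).subtype) (fun e => Subgroup.subtype _) (fun e s g => ?_) ⟨?_, ?_⟩ ⟨?_, ?_⟩
    (fun w => Subtype.val_injective) (fun e => Subtype.val_injective)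
  · cases s <;> rfl
  · rintro ⟨⟨v, ⟨⟩⟩, ⟨⟩⟩ ⟨⟨w, ⟨⟩⟩, ⟨⟩⟩ (rfl : v = w)
    rfl
  · exact fun v => ⟨⟨(v, ⟨⟩), trivial⟩, rfl⟩
  · rintro ⟨⟨v, ⟨⟩⟩, ⟨⟩⟩ ⟨⟨w, ⟨⟩⟩, ⟨⟩⟩ (rfl : v = w)
    rfl
  · exact fun v => ⟨⟨(v, ⟨⟩), trivial⟩, rfl⟩

/-! ### Point stabilizers as fundamental groups -/

theorem exists_orbit_representatives {A X : Type*} [Group A] (f : A →* Equiv.Perm X) :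
    ∃ (rep : X → X) (sec : X → A), (∀ x, f (sec x) (rep x) = x) ∧ ∀ a x, rep (f a x) = rep x := by
  let s : Setoid X :=
    { r := fun x y => ∃ a, f a x = y
      iseqv :=
        { refl := fun x => ⟨1, by simp⟩
          symm := by
            rintro x _ ⟨a, rfl⟩
            exact ⟨a⁻¹, by simp⟩
          trans := by
            rintro x _ _ ⟨a, rfl⟩ ⟨b, rfl⟩
            exact ⟨b * a, by simp⟩ } }
  have h : ∀ x, ∃ a, f a (Quotient.mk s x).out = x := fun x => Quotient.mk_out (s := s) x
  choose sec hsec using h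
  refine ⟨fun x => (Quotient.mk s x).out, sec, hsec, fun a x => ?_⟩
  have : Quotient.mk s (f a x) = Quotient.mk s x := (Quotient.sound ⟨a, rfl⟩ : Quotient.mk s x = _).symm
  simp only [this]

/-- A permutation representation of the path group on a finite set, such that every point has the
same stabilizer `H v` in the vertex group at `v`, together with a choice of a representative `rep v x`
of the orbit of each point `x` under each vertex group, and similarly for the edge groups. -/
structure StabilizerData (𝒢 : GraphOfGroups.{u}) (v₀ : 𝒢.V) where
  H : ∀ v, Subgroup (𝒢.vGrp v)
  att_mem_iff : ∀ e (g : 𝒢.eGrp e),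
    𝒢.att e true g ∈ H (𝒢.vert e true) ↔ 𝒢.att e false g ∈ H (𝒢.vert e false)
  comm : ∀ v (g h : 𝒢.vGrp v), g * h = h * g
  X : Type u
  ρ : 𝒢.PathGroup →* Equiv.Perm X
  ρ_eq_iff : ∀ v g x, ρ (𝒢.ofV v g) x = x ↔ g ∈ H v
  rep : 𝒢.V → X → X
  sec : ∀ v, X → 𝒢.vGrp v
  ρ_sec : ∀ v x, ρ (𝒢.ofV v (sec v x)) (rep v x) = x
  rep_ρ : ∀ v g x, rep v (ρ (𝒢.ofV v g) x) = rep v x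
  repE : 𝒢.E → X → X
  secE : ∀ e, X → 𝒢.eGrp e
  ρ_secE : ∀ e x, ρ (𝒢.ofV _ (𝒢.att e false (secE e x))) (repE e x) = x
  repE_ρ : ∀ e g x, repE e (ρ (𝒢.ofV _ (𝒢.att e false g)) x) = repE e x
  x₀ : X
  rep_x₀ : rep v₀ x₀ = x₀

namespace StabilizerData

variable {𝒢 : GraphOfGroups.{u}} {v₀ : 𝒢.V} (S : StabilizerData 𝒢 v₀)

theorem rep_rep (v : 𝒢.V) (x : S.X) : S.rep v (S.rep v x) = S.rep v x := by
  conv_rhs => rw [← S.ρ_sec v x, S.rep_ρ]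

theorem repE_repE (e : 𝒢.E) (x : S.X) : S.repE e (S.repE e x) = S.repE e x := by
  conv_rhs => rw [← S.ρ_secE e x, S.repE_ρ]

/-- The point `x`, seen over the vertex `v`, belongs to the component of the base point. -/
def Reach (v : 𝒢.V) (x : S.X) : Prop := ∃ c, 𝒢.IsPath v v₀ c ∧ S.ρ c S.x₀ = x

theorem Reach.ρ {S : StabilizerData 𝒢 v₀} {u v : 𝒢.V} {x : S.X} (h : S.Reach v x)
    {p : 𝒢.PathGroup} (hp : 𝒢.IsPath u v p) : S.Reach u (S.ρ p x) := by
  obtain ⟨c, hc, rfl⟩ := h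
  exact ⟨p * c, hp.mul hc, by simp⟩

theorem Reach.rep {S : StabilizerData 𝒢 v₀} {v : 𝒢.V} {x : S.X} (h : S.Reach v x) :
    S.Reach v (S.rep v x) := by
  have h₁ := h.ρ (IsPath.ofV v (S.sec v x)).inv
  have h₂ : S.ρ (𝒢.ofV v (S.sec v x))⁻¹ x = S.rep v x := by
    rw [map_inv, Equiv.Perm.inv_eq_iff_eq, S.ρ_sec]
  rwa [h₂] at h₁

/-- For `x` over the initial vertex of `e`, the corresponding point over the end `s` of `e`. -/
def transport (e : 𝒢.E) (s : Bool) (x : S.X) : S.X :=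
  if s then (S.ρ (𝒢.letter e))⁻¹ x else x

theorem Reach.transport {S : StabilizerData 𝒢 v₀} {e : 𝒢.E} {x : S.X}
    (h : S.Reach (𝒢.vert e false) x) (s : Bool) : S.Reach (𝒢.vert e s) (S.transport e s x) := by
  cases s
  · exact h
  · have := h.ρ (IsPath.letter e).inv
    rwa [map_inv] at this

/-- The graph of groups of the stabilizer of the base point: its vertices are the representatives
of the orbits of the vertex groups in the component of the base point, and its edges are the
representatives of the orbits of the edge groups. -/
abbrev graph : GraphOfGroups.{u} :=
  cover S.H S.att_mem_iff (fun v x => S.rep v x = x ∧ S.Reach v x)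
    (fun e x => S.repE e x = x ∧ S.Reach (𝒢.vert e false) x)
    (fun e s x => S.rep (𝒢.vert e s) (S.transport e s x))
    (fun _ s _ h => ⟨S.rep_rep _ _, (h.2.transport s).rep⟩)

/-- The vertex of the point `x` over `v`. -/
def vtx (v : 𝒢.V) (x : S.X) (h : S.Reach v x) : S.graph.V :=
  ⟨(v, S.rep v x), S.rep_rep v x, h.rep⟩

theorem vtx_congr {v : 𝒢.V} {x y : S.X} (hx : S.Reach v x) (hy : S.Reach v y)
    (h : S.rep v x = S.rep v y) : S.vtx v x hx = S.vtx v y hy :=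
  Subtype.ext (Prod.ext rfl h)

theorem vtx_self (w : S.graph.V) : S.vtx w.1.1 w.1.2 w.2.2 = w :=
  Subtype.ext (Prod.ext rfl w.2.1)

theorem ofV_mul_comm (S : StabilizerData 𝒢 v₀) (v : 𝒢.V) (g h : 𝒢.vGrp v) :
    𝒢.ofV v g * 𝒢.ofV v h = 𝒢.ofV v h * 𝒢.ofV v g := by
  rw [← map_mul, S.comm, map_mul]

theorem ρ_letter_att (e : 𝒢.E) (g : 𝒢.eGrp e) (x : S.X) :
    S.ρ (𝒢.letter e) (S.ρ (𝒢.ofV _ (𝒢.att e true g)) x) =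
      S.ρ (𝒢.ofV _ (𝒢.att e false g)) (S.ρ (𝒢.letter e) x) := by
  rw [← Equiv.Perm.mul_apply, ← map_mul, letter_mul_ofV, map_mul, Equiv.Perm.mul_apply]

theorem exists_hom : ∃ Φ : S.graph.PathGroup →* 𝒢.PathGroup,
    (∀ (w : S.graph.V) (g : S.H w.1.1), Φ (S.graph.ofV w g) = 𝒢.ofV w.1.1 g.1) ∧
    ∀ e : S.graph.E, Φ (S.graph.letter e) =
      (𝒢.ofV _ (S.sec (𝒢.vert e.1.1 false) e.1.2))⁻¹ * 𝒢.letter e.1.1 *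
        𝒢.ofV _ (S.sec (𝒢.vert e.1.1 true) (S.transport e.1.1 true e.1.2)) := by
  obtain ⟨Φ, h₁, h₂⟩ := exists_pathGroup_hom (𝒢 := S.graph)
    (fun w => (𝒢.ofV w.1.1).comp (S.H w.1.1).subtype)
    (fun e => (𝒢.ofV _ (S.sec (𝒢.vert e.1.1 false) e.1.2))⁻¹ * 𝒢.letter e.1.1 *
        𝒢.ofV _ (S.sec (𝒢.vert e.1.1 true) (S.transport e.1.1 true e.1.2))) (fun e g => by
      change _ * 𝒢.ofV (𝒢.vert e.1.1 true) (𝒢.att e.1.1 true g.1) =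
        𝒢.ofV (𝒢.vert e.1.1 false) (𝒢.att e.1.1 false g.1) * _
      rw [mul_assoc, S.ofV_mul_comm, mul_assoc, ← mul_assoc (𝒢.letter _), letter_mul_ofV]
      rw [← mul_assoc, ← mul_assoc, ← map_inv, S.ofV_mul_comm]
      simp only [mul_assoc])
  exact ⟨Φ, fun w g => h₁ w g, h₂⟩

/-- The homomorphism of path groups that sends the letter of an edge to a path between the
representatives of its ends. -/
noncomputable def Φ : S.graph.PathGroup →* 𝒢.PathGroup := S.exists_hom.choose

theorem Φ_ofV (w : S.graph.V) (g : S.H w.1.1) : S.Φ (S.graph.ofV w g) = 𝒢.ofV w.1.1 g.1 :=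
  S.exists_hom.choose_spec.1 w g

theorem Φ_letter (e : S.graph.E) : S.Φ (S.graph.letter e) =
    (𝒢.ofV _ (S.sec (𝒢.vert e.1.1 false) e.1.2))⁻¹ * 𝒢.letter e.1.1 *
      𝒢.ofV _ (S.sec (𝒢.vert e.1.1 true) (S.transport e.1.1 true e.1.2)) :=
  S.exists_hom.choose_spec.2 e

theorem ρ_inv_sec (v : 𝒢.V) (x : S.X) : S.ρ (𝒢.ofV v (S.sec v x))⁻¹ x = S.rep v x := by
  rw [map_inv, Equiv.Perm.inv_eq_iff_eq, S.ρ_sec]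

theorem isPath_Φ {w w' : S.graph.V} {y : S.graph.PathGroup} (h : S.graph.IsPath w w' y) :
    𝒢.IsPath w.1.1 w'.1.1 (S.Φ y) ∧ S.ρ (S.Φ y) w'.1.2 = w.1.2 := by
  induction h with
  | ofV w g =>
    rw [Φ_ofV]
    exact ⟨.ofV _ _, (S.ρ_eq_iff _ _ _).2 g.2⟩
  | letter e =>
    rw [Φ_letter]
    refine ⟨((IsPath.ofV _ _).inv.mul (.letter _)).mul (.ofV _ _), ?_⟩
    change S.ρ _ (S.rep _ (S.transport e.1.1 true e.1.2)) = S.rep _ e.1.2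
    rw [map_mul, map_mul, Equiv.Perm.mul_apply, Equiv.Perm.mul_apply, S.ρ_sec, ← S.ρ_inv_sec]
    simp [transport]
  | inv _ ih =>
    rw [map_inv, map_inv, Equiv.Perm.inv_eq_iff_eq]
    exact ⟨ih.1.inv, ih.2.symm⟩
  | mul _ _ ih₁ ih₂ =>
    rw [map_mul, map_mul, Equiv.Perm.mul_apply, ih₂.2, ih₁.2]
    exact ⟨ih₁.1.mul ih₂.1, rfl⟩

/-- The path `p` from `u` to `v`, acting on the point `x` over `v`, lifts to a path in the graph of
groups of the stabilizer. -/
def Lifts (u v : 𝒢.V) (p : 𝒢.PathGroup) (x : S.X) : Prop :=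
  ∀ (hx : S.Reach v x) (hy : S.Reach u (S.ρ p x)),
    ∃ p', S.graph.IsPath (S.vtx u _ hy) (S.vtx v x hx) p' ∧
      S.Φ p' = (𝒢.ofV u (S.sec u (S.ρ p x)))⁻¹ * p * 𝒢.ofV v (S.sec v x)

variable {S}

theorem Lifts.mul {u v w : 𝒢.V} {p q : 𝒢.PathGroup} {x : S.X} (hp : S.Lifts u v p (S.ρ q x))
    (hq : S.Lifts v w q x) (hq' : 𝒢.IsPath v w q) : S.Lifts u w (p * q) x := by
  intro hx hy
  have hpq : S.ρ (p * q) x = S.ρ p (S.ρ q x) := by simp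
  revert hy
  rw [hpq]
  intro hy
  obtain ⟨q', hq₁, hq₂⟩ := hq hx (hx.ρ hq')
  obtain ⟨p', hp₁, hp₂⟩ := hp (hx.ρ hq') hy
  exact ⟨p' * q', hp₁.mul hq₁, by rw [map_mul, hp₂, hq₂]; group⟩

theorem Lifts.inv {u v : 𝒢.V} {p : 𝒢.PathGroup} {x : S.X}
    (hp : S.Lifts u v p (S.ρ p⁻¹ x)) : S.Lifts v u p⁻¹ x := by
  intro hx hy
  have hpp : S.ρ p (S.ρ p⁻¹ x) = x := by simp
  obtain ⟨p', hp₁, hp₂⟩ := hp hy (by rwa [hpp])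
  refine ⟨p'⁻¹, ?_, ?_⟩
  · have := hp₁.inv
    simpa only [hpp] using this
  · rw [map_inv, hp₂, hpp]; group

theorem lifts_ofV (v : 𝒢.V) (g : 𝒢.vGrp v) (x : S.X) : S.Lifts v v (𝒢.ofV v g) x := by
  intro hx hy
  have hmem : (S.sec v (S.ρ (𝒢.ofV v g) x))⁻¹ * g * S.sec v x ∈ S.H v := by
    rw [← S.ρ_eq_iff v _ (S.rep v x)]
    simp only [map_mul, Equiv.Perm.mul_apply, S.ρ_sec]
    rw [map_inv, S.ρ_inv_sec, S.rep_ρ]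
  refine ⟨S.graph.ofV (S.vtx v x hx) ⟨_, hmem⟩, ?_, ?_⟩
  · rw [S.vtx_congr hy hx (S.rep_ρ v g x)]
    exact .ofV _ _
  · rw [Φ_ofV]
    change 𝒢.ofV v _ = _
    rw [map_mul, map_mul, map_inv]

theorem lifts_letter (e : 𝒢.E) (x : S.X) :
    S.Lifts (𝒢.vert e false) (𝒢.vert e true) (𝒢.letter e) x := by
  -- points whose image is the representative of an orbit of the edge group
  have special : ∀ x, S.repE e (S.ρ (𝒢.letter e) x) = S.ρ (𝒢.letter e) x →
      S.Lifts (𝒢.vert e false) (𝒢.vert e true) (𝒢.letter e) x := by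
    intro x hrep hx hy
    let e' : S.graph.E := ⟨(e, S.ρ (𝒢.letter e) x), hrep, hy⟩
    have htr : S.transport e true (S.ρ (𝒢.letter e) x) = x := by simp [transport]
    refine ⟨S.graph.letter e', ?_, ?_⟩
    · have h₁ : S.graph.vert e' false = S.vtx _ _ hy := rfl
      have h₂ : S.graph.vert e' true = S.vtx _ _ hx :=
        Subtype.ext (Prod.ext rfl (congrArg (S.rep (𝒢.vert e true)) htr))
      rw [← h₁, ← h₂]
      exact .letter e'
    · rw [Φ_letter]
      change (𝒢.ofV _ (S.sec _ (S.ρ (𝒢.letter e) x)))⁻¹ * 𝒢.letter e *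
        𝒢.ofV _ (S.sec _ (S.transport e true (S.ρ (𝒢.letter e) x))) = _
      rw [htr]
  -- the general case follows by moving the point by an element of the edge group
  let c := S.secE e (S.ρ (𝒢.letter e) x)
  have hc : 𝒢.letter e = 𝒢.ofV _ (𝒢.att e false c) *
      (𝒢.letter e * 𝒢.ofV _ (𝒢.att e true c⁻¹)) := by
    rw [letter_mul_ofV, ← mul_assoc, ← map_mul, ← map_mul]
    simp
  rw [hc]
  refine (lifts_ofV _ _ _).mul ((special _ ?_).mul (lifts_ofV _ _ _) (.ofV _ _))
    ((IsPath.letter e).mul (.ofV _ _))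
  rw [ρ_letter_att, map_inv (𝒢.att e false), map_inv (𝒢.ofV _), map_inv S.ρ]
  have h₁ : (S.ρ (𝒢.ofV _ (𝒢.att e false c)))⁻¹ (S.ρ (𝒢.letter e) x) =
      S.repE e (S.ρ (𝒢.letter e) x) := by
    rw [Equiv.Perm.inv_eq_iff_eq, S.ρ_secE]
  rw [h₁, repE_repE]

theorem lifts_of_isPath {u v : 𝒢.V} {p : 𝒢.PathGroup} (hp : 𝒢.IsPath u v p) :
    ∀ x, S.Lifts u v p x := by
  induction hp with
  | ofV v g => exact lifts_ofV v g
  | letter e => exact lifts_letter e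
  | inv _ ih => exact fun x => (ih _).inv
  | mul _ h ih₁ ih₂ => exact fun x => (ih₁ _).mul (ih₂ x) h

variable (S)

/-- The base vertex of the graph of groups of the stabilizer. -/
def base : S.graph.V := S.vtx v₀ S.x₀ ⟨1, IsPath.one v₀, by simp⟩

theorem connected_graph : S.graph.Connected := by
  refine ⟨⟨S.base⟩, ?_⟩
  suffices h : ∀ w, Relation.EqvGen
      (fun a b => ∃ e, S.graph.vert e false = a ∧ S.graph.vert e true = b) w S.base from
    fun v w => .trans _ _ _ (h v) (.symm _ _ (h w))
  intro w
  obtain ⟨c, hc, hcx⟩ := w.2.2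
  obtain ⟨p', hp', -⟩ := lifts_of_isPath hc S.x₀ ⟨1, IsPath.one v₀, by simp⟩ (hcx ▸ w.2.2)
  have h := hp'.eqvGen
  rwa [S.vtx_congr _ w.2.2 (by rw [hcx]), S.vtx_self] at h

/-! The restriction of `Φ` to the fundamental group is injective because it maps reduced words to
reduced words. -/

section Injectivity

variable (C : 𝒢.Coordinates) (D : S.graph.Coordinates)

/-- The coordinates in `𝒢` of a vector in a vertex group of the graph of the stabilizer. -/
def lat (w : S.graph.V) (z : ℤ × ℤ) : ℤ × ℤ :=
  (C.cV w.1.1 ((D.cV w).symm (Multiplicative.ofAdd z) : S.H w.1.1).1).toAdd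

theorem Φ_el (w : S.graph.V) (z : ℤ × ℤ) : S.Φ (D.el w z) = C.el w.1.1 (S.lat C D w z) := by
  rw [lat, ← C.ofV_eq_el, ← S.Φ_ofV]
  rfl

theorem ρ_el_lat (w : S.graph.V) (z : ℤ × ℤ) (x : S.X) :
    S.ρ (C.el w.1.1 (S.lat C D w z)) x = x := by
  rw [lat, ← C.ofV_eq_el, S.ρ_eq_iff]
  exact ((D.cV w).symm (Multiplicative.ofAdd z) : S.H w.1.1).2

/-- If the image of a vector belongs to an edge group of `𝒢`, the vector belongs to the
corresponding edge group. -/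
theorem exists_eq_smul_vec_of_lat (e : S.graph.E) (s : Bool) (z : ℤ × ℤ) (n : ℤ)
    (h : S.lat C D (S.graph.vert e s) z = n • C.vec e.1.1 s) : ∃ m : ℤ, z = m • D.vec e s := by
  let g : 𝒢.eGrp e.1.1 := C.gen e.1.1 ^ n
  let y : S.H (𝒢.vert e.1.1 s) := (D.cV (S.graph.vert e s)).symm (Multiplicative.ofAdd z)
  have hy : y.1 = 𝒢.att e.1.1 s g := by
    apply (C.cV _).injective
    apply Multiplicative.toAdd.injective
    rw [C.cV_att]
    refine Eq.trans h ?_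
    simp [g, Coordinates.gen]
  have hg : 𝒢.att e.1.1 false g ∈ S.H (𝒢.vert e.1.1 false) := by
    have h₁ : 𝒢.att e.1.1 s g ∈ S.H (𝒢.vert e.1.1 s) := hy ▸ y.2
    cases s
    · exact h₁
    · exact (S.att_mem_iff _ _).1 h₁
  let g' : S.graph.eGrp e := ⟨g, hg⟩
  refine ⟨(D.cE e g').toAdd, ?_⟩
  rw [← D.cV_att]
  have h₂ : S.graph.att e s g' = (D.cV (S.graph.vert e s)).symm (Multiplicative.ofAdd z) :=
    Subtype.ext hy.symm
  rw [h₂]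
  simp

/-- The coordinates of the element that moves the representative at the end `s` of an edge to the
point of that edge. -/
def secVec (e : S.graph.E) (s : Bool) : ℤ × ℤ :=
  (C.cV _ (S.sec (𝒢.vert e.1.1 s) (S.transport e.1.1 s e.1.2))).toAdd

theorem Φ_dirLetter (e : S.graph.E) (s : Bool) : S.Φ (S.graph.dirLetter e s) =
    C.el (𝒢.vert e.1.1 (!s)) (-S.secVec C e (!s)) * 𝒢.dirLetter e.1.1 s *
      C.el (𝒢.vert e.1.1 s) (S.secVec C e s) := by
  simp only [Coordinates.el_neg, secVec, ← C.ofV_eq_el]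
  cases s
  · simp only [dirLetter, Bool.false_eq_true, if_false, map_inv, Φ_letter]
    rw [mul_inv_rev, mul_inv_rev, inv_inv, mul_assoc]
    rfl
  · simp only [dirLetter, if_true, Φ_letter]
    rfl

/-- The vector in front of the image of a word. -/
def headVec : List (S.graph.E × Bool × (ℤ × ℤ)) → ℤ × ℤ
  | [] => 0
  | (e, s, _) :: _ => -S.secVec C e (!s)

/-- The image of a word under `Φ`. -/
def mapWord : List (S.graph.E × Bool × (ℤ × ℤ)) → List (𝒢.E × Bool × (ℤ × ℤ))
  | [] => []
  | (e, s, z) :: l =>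
    (e.1.1, s, S.secVec C e s + S.lat C D (S.graph.vert e s) z + S.headVec C l) :: mapWord l

theorem Φ_val (l : List (S.graph.E × Bool × (ℤ × ℤ))) : ∀ w w', Coordinates.IsWord w l w' →
    S.Φ (D.val l) = C.el w.1.1 (S.headVec C l) * C.val (S.mapWord C D l) := by
  induction l with
  | nil => intro w w' _; simp [Coordinates.val, headVec, mapWord]
  | cons a l ih =>
    obtain ⟨e, s, z⟩ := a
    rintro w w' ⟨rfl, hl⟩
    rw [Coordinates.val, map_mul, map_mul, ih _ _ hl, S.Φ_el C, S.Φ_dirLetter C, mapWord, headVec,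
      Coordinates.val]
    change _ * C.el (𝒢.vert e.1.1 s) _ * (C.el (𝒢.vert e.1.1 s) _ * _) =
      C.el (𝒢.vert e.1.1 (!s)) _ * _
    simp only [Coordinates.el_add, mul_assoc]

theorem reduced_mapWord (l : List (S.graph.E × Bool × (ℤ × ℤ))) :
    ∀ w w', Coordinates.IsWord w l w' → D.Reduced (fun _ => ⊥) l →
      C.Reduced (fun _ => ⊥) (S.mapWord C D l) := by
  induction l with
  | nil => intro _ _ _ _; exact List.isChain_nil
  | cons a l ih =>
    obtain ⟨e, s, z⟩ := a
    rintro w w' ⟨rfl, hl⟩ hred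
    match l, hl, hred, ih with
    | [], _, _, _ => exact List.isChain_singleton _
    | (e₂, s₂, z₂) :: l, hl, hred, ih =>
      refine List.isChain_cons_cons.2 ⟨?_, ih _ _ hl hred.tail⟩
      have hne := (List.isChain_cons_cons.1 hred).1
      rintro ⟨h₁, h₂, n, hn⟩
      simp only at h₁ h₂ hn hne
      subst h₂
      obtain ⟨⟨e, x⟩, hx, hxr⟩ := e
      obtain ⟨⟨e₂, x₂⟩, hx₂, hxr₂⟩ := e₂
      simp only at h₁ hx hx₂ hxr hxr₂
      subst h₁
      rw [AddSubgroup.mem_bot, sub_eq_zero, headVec] at hn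
      have hv := hl.1
      rw [Bool.not_not] at hn hv
      set w₁ : S.graph.V := S.graph.vert ⟨(e₂, x), hx, hxr⟩ s with hw₁
      have hr : S.rep (𝒢.vert e₂ s) (S.transport e₂ s x₂) =
        S.rep (𝒢.vert e₂ s) (S.transport e₂ s x) := congrArg (fun w : S.graph.V => w.1.2) hv
      -- the two points over the edge differ by an element of the edge group
      have hpt : S.ρ (C.el (𝒢.vert e₂ s) (n • C.vec e₂ s)) (S.transport e₂ s x₂) =
          S.transport e₂ s x := by
        have h₃ : ∀ (x : S.X) hq, S.ρ (C.el (𝒢.vert e₂ s) (S.secVec C ⟨(e₂, x), hq⟩ s))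
            (S.rep (𝒢.vert e₂ s) (S.transport e₂ s x)) = S.transport e₂ s x := by
          intro x hq
          rw [secVec, ← C.ofV_eq_el, S.ρ_sec]
        have h₄ := h₃ x₂ ⟨hx₂, hxr₂⟩
        have h₅ := h₃ x ⟨hx, hxr⟩
        rw [← hn, ← h₄, hr, ← Equiv.Perm.mul_apply, ← map_mul, ← Coordinates.el_add,
          neg_add_cancel_right, Coordinates.el_add, map_mul, Equiv.Perm.mul_apply,
          S.ρ_el_lat C D w₁, h₅]
      have hxx : S.ρ (C.el (𝒢.vert e₂ false) (n • C.vec e₂ false)) x₂ = x := by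
        cases s
        · exact hpt
        · rw [C.el_zsmul_vec] at hpt ⊢
          simp only [transport, if_true] at hpt
          have h₃ := congrArg (S.ρ (𝒢.letter e₂)) hpt
          rw [ρ_letter_att] at h₃
          simpa using h₃
      have hx₁ : x₂ = x := by
        rw [C.el_zsmul_vec] at hxx
        rw [← hx, ← hxx, S.repE_ρ, hx₂]
      subst hx₁
      refine hne ⟨rfl, rfl, ?_⟩
      obtain ⟨m, hm⟩ := S.exists_eq_smul_vec_of_lat C D ⟨(e₂, x₂), hx, hxr⟩ s z n (by
        rw [← hn]; abel)
      exact ⟨m, by rw [hm]; exact sub_self _⟩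

theorem eq_one_of_Φ_eq_one (C : 𝒢.Coordinates) (D : S.graph.Coordinates) [Finite 𝒢.V] {w : S.graph.V} {y : S.graph.PathGroup}
    (hy : S.graph.IsPath w w y) (h : S.Φ y = 1) : y = 1 := by
  obtain ⟨z, l, hl, hred, rfl⟩ := D.hasReducedWord_of_isPath hy
  rw [map_mul, S.Φ_val C D l _ _ hl, S.Φ_el C D, ← mul_assoc, ← Coordinates.el_add] at h
  by_cases hl0 : l = []
  · subst hl0
    simp only [headVec, mapWord, Coordinates.val, mul_one, add_zero] at h ⊢
    rw [← C.el_zero w.1.1] at h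
    have h₁ := C.el_injective _ h
    have h₂ : ((D.cV w).symm (Multiplicative.ofAdd z) : S.H w.1.1) = 1 := by
      apply Subtype.ext
      apply (C.cV _).injective
      rw [Subgroup.coe_one, map_one]
      exact h₁
    have h₃ : (D.cV w).symm (Multiplicative.ofAdd z) = 1 := h₂
    rw [Coordinates.el, h₃, map_one]
  · exfalso
    refine C.val_ne_el (S.reduced_mapWord C D l _ _ hl hred) ?_ w.1.1
      (-(S.lat C D w z + S.headVec C l)) ?_
    · cases l
      · exact absurd rfl hl0
      · simp [mapWord]
    · rw [Coordinates.el_neg]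
      exact eq_inv_of_mul_eq_one_right h

end Injectivity

theorem exists_mulEquiv_piOne [Finite 𝒢.V] (C : 𝒢.Coordinates) (D : S.graph.Coordinates)
    [Finite S.X] : ∃ K : Subgroup (𝒢.piOne v₀), K.FiniteIndex ∧
      Nonempty (K ≃* S.graph.piOne S.base) := by
  let K : Subgroup (𝒢.piOne v₀) :=
    (MulAction.stabilizer (Equiv.Perm S.X) S.x₀).comap (S.ρ.comp (𝒢.piOne v₀).subtype)
  have hK : ∀ y : 𝒢.piOne v₀, y ∈ K ↔ S.ρ y S.x₀ = S.x₀ := fun y => Iff.rfl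
  refine ⟨K, finiteIndex_comap _ _, ?_⟩
  let f : S.graph.piOne S.base →* 𝒢.piOne v₀ :=
    (S.Φ.comp (S.graph.piOne S.base).subtype).codRestrict _ fun y => (S.isPath_Φ y.2).1
  refine nonempty_mulEquiv_of_range_eq (f := f) ?_ ?_
  · refine (injective_iff_map_eq_one _).2 fun y hy => Subtype.ext ?_
    exact S.eq_one_of_Φ_eq_one C D y.2 (congrArg Subtype.val hy)
  · ext y
    rw [hK]
    constructor
    · rintro ⟨p, rfl⟩
      have := (S.isPath_Φ p.2).2
      change S.ρ _ (S.rep v₀ S.x₀) = S.rep v₀ S.x₀ at this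
      rw [S.rep_x₀] at this
      exact this
    · intro hy
      have hbase : S.Reach v₀ S.x₀ := ⟨1, IsPath.one v₀, by simp⟩
      obtain ⟨p, hp, hp'⟩ := lifts_of_isPath (S := S) y.2 S.x₀ hbase (hy.symm ▸ hbase)
      have hp₁ : S.graph.IsPath S.base S.base p := by
        simpa only [hy, base] using hp
      have hsec : S.sec v₀ S.x₀ ∈ S.H v₀ := by
        rw [← S.ρ_eq_iff v₀ _ S.x₀]
        have := S.ρ_sec v₀ S.x₀
        rwa [S.rep_x₀] at this
      let h : S.graph.PathGroup := S.graph.ofV S.base ⟨_, hsec⟩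
      have hh : S.Φ h = 𝒢.ofV v₀ (S.sec v₀ S.x₀) := S.Φ_ofV _ _
      refine ⟨⟨h * p * h⁻¹, ((IsPath.ofV _ _).mul hp₁).mul (IsPath.ofV _ _).inv⟩, Subtype.ext ?_⟩
      change S.Φ (h * p * h⁻¹) = y
      rw [map_mul, map_mul, map_inv, hh, hp', hy]
      group

end StabilizerData

theorem IsTubular.isVirtuallyPrimitive_of_isRegulating {𝒢 : GraphOfGroups.{u}} (h𝒢 : 𝒢.IsTubular)
    (v₀ : 𝒢.V) {k : 𝒢.E → ℤ} (hk : 𝒢.IsRegulating k) : IsVirtuallyPrimitive (𝒢.piOne v₀) := by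
  obtain ⟨C⟩ := h𝒢.nonempty_coordinates
  have := h𝒢.finite_V
  obtain ⟨H, hfin, hH⟩ := C.exists_regulates_finiteIndex hk
  let L : 𝒢.V → AddSubgroup (ℤ × ℤ) := fun v =>
    Subgroup.toAddSubgroup' ((H v).comap (C.cV v).symm.toMonoidHom)
  have hL : ∀ v z, z ∈ L v ↔ (C.cV v).symm (Multiplicative.ofAdd z) ∈ H v := fun v z => Iff.rfl
  have hLv : ∀ e s (n : ℤ), n • C.vec e s ∈ L (𝒢.vert e s) ↔ k e ∣ n := by
    intro e s n
    rw [hL, ← hH.att_gen_zpow_mem e s n]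
    congr! 1
    apply (C.cV _).injective
    apply Multiplicative.toAdd.injective
    rw [C.cV_att]
    simp [Coordinates.gen]
  obtain ⟨X, hX, ρ, hρ, x, -⟩ := C.exists_hom_perm_finite L
    (fun e n => (hLv e true n).trans (hLv e false n).symm) (fun v => by
      have := finiteIndex_comap (C.cV v).symm.toMonoidHom (H v)
      exact ⟨this.index_ne_zero⟩) [] List.isChain_nil
  choose rep sec hrep₁ hrep₂ using fun v => exists_orbit_representatives (ρ.comp (𝒢.ofV v))
  choose repE secE hrepE₁ hrepE₂ using fun e =>
    exists_orbit_representatives (ρ.comp ((𝒢.ofV _).comp (𝒢.att e false)))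
  let S : StabilizerData 𝒢 v₀ :=
    { H := H
      att_mem_iff := hH.att_mem_iff
      comm := fun v g h => (C.cV v).injective (by rw [map_mul, map_mul, mul_comm])
      X := X
      ρ := ρ
      ρ_eq_iff := fun v g x => by rw [C.ofV_eq_el, hρ, hL]; simp
      rep := rep
      sec := sec
      ρ_sec := hrep₁
      rep_ρ := hrep₂
      repE := repE
      secE := secE
      ρ_secE := hrepE₁
      repE_ρ := hrepE₂
      x₀ := rep v₀ x
      rep_x₀ := by conv_rhs => rw [← hrep₁ v₀ x, hrep₂] }
  have htub : S.graph.IsTubular := isTubular_cover (X := X) h𝒢 hfin hH S.connected_graph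
  obtain ⟨D⟩ := htub.nonempty_coordinates
  have : Finite S.X := hX
  obtain ⟨K, hK, hKS⟩ := S.exists_mulEquiv_piOne C D
  exact ⟨K, hK, S.graph, htub, isPrimitive_cover hH, S.base, hKS⟩

theorem IsTubular.hasPrimitiveTarget_of_hasPrimitiveDomain {𝒢 : GraphOfGroups.{u}}
    (h𝒢 : 𝒢.IsTubular) (h : 𝒢.HasPrimitiveDomain) : 𝒢.HasPrimitiveTarget := by
  obtain ⟨ℋ, h₁, h₂, f, hf⟩ := h
  exact ⟨ℋ, h₁, h₂, exists_isRigid_symm h₁ h𝒢 f hf⟩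

theorem IsTubular.hasPrimitiveDomain_of_hasPrimitiveTarget {𝒢 : GraphOfGroups.{u}}
    (h𝒢 : 𝒢.IsTubular) (h : 𝒢.HasPrimitiveTarget) : 𝒢.HasPrimitiveDomain := by
  obtain ⟨ℋ, h₁, h₂, f, hf⟩ := h
  exact ⟨ℋ, h₁, h₂, exists_isRigid_symm h𝒢 h₁ f hf⟩

end GraphOfGroups

theorem mainTheorem1 (𝒢 : GraphOfGroups.{u}) (h𝒢 : 𝒢.IsTubular) (v₀ : 𝒢.V) :
    List.TFAE [
      Group.ResiduallyFinite (𝒢.piOne v₀),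
      𝒢.HasPrimitiveDomain,
      𝒢.HasPrimitiveTarget,
      IsVirtuallyPrimitive (𝒢.piOne v₀),
      ∀ (e : 𝒢.E) (p : 𝒢.PathGroup), 𝒢.IsPath v₀ (𝒢.vert e false) p →
        IsSeparableSubgroup (𝒢.edgeSubgroup v₀ e p),
      ∃ k : 𝒢.E → ℤ, 𝒢.IsRegulating k] := by
  tfae_have 1 → 5 := fun h => h𝒢.isSeparableSubgroup_edgeSubgroup h
  tfae_have 5 → 6 := fun h => h𝒢.exists_isRegulating_of_isSeparable h
  tfae_have 6 → 4 := fun ⟨_, hk⟩ => h𝒢.isVirtuallyPrimitive_of_isRegulating v₀ hk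
  tfae_have 4 → 1 := fun h => GraphOfGroups.residuallyFinite_of_isVirtuallyPrimitive h
  tfae_have 6 → 2 := fun ⟨_, hk⟩ => h𝒢.hasPrimitiveDomain_of_isRegulating hk
  tfae_have 2 → 6 := fun h => GraphOfGroups.exists_isRegulating_of_hasPrimitiveDomain h𝒢 h
  tfae_have 2 → 3 := fun h => h𝒢.hasPrimitiveTarget_of_hasPrimitiveDomain h
  tfae_have 3 → 2 := fun h => h𝒢.hasPrimitiveDomain_of_hasPrimitiveTarget h
  tfae_finish
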